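/- For a nondegenerate closed triangle $T=\triangle ABC$ in the Euclidean plane let $a=|BC|$, $b=|CA|$, $c=|AB|$, and let $$V(P)=\iint_T \frac{dQ}{|PQ|}$$ (integration with respect to area) be the potential at a point $P$ of the plane. Then $V$ attains its maximum over the whole plane at exactly one point $P_{\max}=P_{\max}(T)$, and $P_{\max}$ lies in the interior of $T$. For every triple $(a,b,c)$ of side lengths of a nondegenerate triangle, the equation $$\sqrt{(u^2-a^2)\big(a^2-(v-w)^2\big)}+\sqrt{(v^2-b^2)\big(b^2-(w-u)^2\big)}+\sqrt{(w^2-c^2)\big(c^2-(u-v)^2\big)}=\sqrt{2(a^2b^2+b^2c^2+c^2a^2)-(a^4+b^4+c^4)},$$ where $u=a\coth\frac{a\lambda}{a+b+c}$, $v=b\coth\frac{b\lambda}{a+b+c}$, $w=c\coth\frac{c\lambda}{a+b+c}$, has exactly one solution $\lambda>0$, denoted by $\lambda_{\max}=\lambda_{\max}(a,b,c)$. Define $$f(a,b,c)=\sqrt{\Big(\coth^2\tfrac{a\lambda_{\max}}{a+b+c}-1\Big)\Big(a^2-\big(b\coth\tfrac{b\lambda_{\max}}{a+b+c}-c\coth\tfrac{c\lambda_{\max}}{a+b+c}\big)^2\Big)}.$$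 Then for every triangle $T$ the point $P_{\max}(T)$ has trilinear coordinates $f(a,b,c):f(b,c,a):f(c,a,b)$, i.e. these three numbers are proportional, with a nonzero factor, to the directed distances from $P_{\max}(T)$ to the lines $BC$, $CA$, $AB$ (positive on the side of the opposite vertex). Moreover, $f$ is a triangle center function: on triples of side lengths of triangles, $f(ta,tb,tc)=t\,f(a,b,c)$ for all $t>0$, $f(a,c,b)=f(a,b,c)$, and $f$ is not identically $0$. Hence $P_{\max}$ is a triangle center in Kimberling's sense, that is, for some function $f$ that is homogeneous of some real order, symmetric in its last two arguments and not identically $0$ on triples of triangle side lengths, it is given for every triangle by the trilinear coordinates $f(a,b,c):f(b,c,a):f(c,a,b)$. -/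

import Mathlib

open scoped ENNReal

namespace ElectrostaticCenter

/-- The Euclidean plane. -/
abbrev Plane : Type := EuclideanSpace ℝ (Fin 2)

/-! ### The maximum potential point

A nondegenerate triangle `ABC` is a `T : Affine.Triangle ℝ Plane`, with vertices
`A = T.points 0`, `B = T.points 1`, `C = T.points 2` (affinely independent). -/

/-- The potential `V(P) = ∬_T dλ(Q) / |PQ|` of the (closed, filled) triangle `T` with unit charge
density, as a Lebesgue integral with values in `[0, ∞]`. -/
noncomputable def potential (T : Affine.Triangle ℝ Plane) (P : Plane) : ℝ≥0∞ :=
  ∫⁻ Q in T.closedInterior, (edist P Q)⁻¹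

/-- `P` is a point of the plane at which the potential of `T` attains its maximum. -/
def IsMaxPotentialPoint (T : Affine.Triangle ℝ Plane) (P : Plane) : Prop :=
  ∀ Q : Plane, potential T Q ≤ potential T P

/-- A choice of maximum potential point of `T` (there is exactly one). -/
noncomputable def maxPotentialPoint (T : Affine.Triangle ℝ Plane) : Plane :=
  Classical.epsilon (IsMaxPotentialPoint T)

/-! ### Trilinear coordinates and triangle centers -/

/-- The side length `a = |BC|`. -/
noncomputable def sideA (T : Affine.Triangle ℝ Plane) : ℝ := dist (T.points 1) (T.points 2)

/-- The side length `b = |CA|`. -/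
noncomputable def sideB (T : Affine.Triangle ℝ Plane) : ℝ := dist (T.points 2) (T.points 0)

/-- The side length `c = |AB|`. -/
noncomputable def sideC (T : Affine.Triangle ℝ Plane) : ℝ := dist (T.points 0) (T.points 1)

/-- `τa : τb : τc` are trilinear coordinates of `P` with respect to `T`: they are proportional,
with a nonzero factor, to the directed distances of `P` from the side lines `BC`, `CA`, `AB`.
`T.signedInfDist i P` is the distance from `P` to the line of the side opposite to vertex `i`,
taken positive on the side of that vertex. -/
def IsTrilinear (T : Affine.Triangle ℝ Plane) (P : Plane) (τa τb τc : ℝ) : Prop :=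
  ∃ k : ℝ, k ≠ 0 ∧
    τa = k * T.signedInfDist 0 P ∧ τb = k * T.signedInfDist 1 P ∧ τc = k * T.signedInfDist 2 P

/-- `(a, b, c)` is the triple of side lengths of a nondegenerate triangle. -/
def IsTriangleSides (a b c : ℝ) : Prop :=
  0 < a ∧ 0 < b ∧ 0 < c ∧ a < b + c ∧ b < c + a ∧ c < a + b

/-- `f` is homogeneous of order `ν` on triples of triangle sides. -/
def HomogeneousOfOrder (f : ℝ → ℝ → ℝ → ℝ) (ν : ℝ) : Prop :=
  ∀ a b c : ℝ, IsTriangleSides a b c → ∀ t : ℝ, 0 < t → f (t * a) (t * b) (t * c) = t ^ ν * f a b c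

/-- `f` is symmetric in its last two arguments on triples of triangle sides. -/
def SymmetricInLastTwo (f : ℝ → ℝ → ℝ → ℝ) : Prop :=
  ∀ a b c : ℝ, IsTriangleSides a b c → f a c b = f a b c

/-- `f` is not identically zero on triples of triangle sides. -/
def NotIdenticallyZero (f : ℝ → ℝ → ℝ → ℝ) : Prop :=
  ∃ a b c : ℝ, IsTriangleSides a b c ∧ f a b c ≠ 0

/-- Kimberling's notion of a triangle center function. Only the values on triples of triangle
sides matter. -/
def IsTriangleCenterFunction (f : ℝ → ℝ → ℝ → ℝ) : Prop :=
  (∃ ν : ℝ, HomogeneousOfOrder f ν) ∧ SymmetricInLastTwo f ∧ NotIdenticallyZero f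

/-- The rule `X`, which assigns a point to each triangle, is given by the trilinear coordinates
`f(a,b,c) : f(b,c,a) : f(c,a,b)`. -/
def HasTrilinearRepresentation (X : Affine.Triangle ℝ Plane → Plane) (f : ℝ → ℝ → ℝ → ℝ) : Prop :=
  ∀ T : Affine.Triangle ℝ Plane,
    IsTrilinear T (X T) (f (sideA T) (sideB T) (sideC T)) (f (sideB T) (sideC T) (sideA T))
      (f (sideC T) (sideA T) (sideB T))

/-- The rule `X` is a triangle center. -/
def IsTriangleCenter (X : Affine.Triangle ℝ Plane → Plane) : Prop :=
  ∃ f : ℝ → ℝ → ℝ → ℝ, IsTriangleCenterFunction f ∧ HasTrilinearRepresentation X f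

/-! ### The parameter `λ_max` and the center function -/

/-- The hyperbolic cotangent. -/
noncomputable def coth (x : ℝ) : ℝ := Real.cosh x / Real.sinh x

/-- The equation
`√((u²-a²)(a²-(v-w)²)) + √((v²-b²)(b²-(w-u)²)) + √((w²-c²)(c²-(u-v)²))
  = √(2(a²b²+b²c²+c²a²) - (a⁴+b⁴+c⁴))`
for `l`, where `u = a coth(al/(a+b+c))`, `v = b coth(bl/(a+b+c))`, `w = c coth(cl/(a+b+c))`. -/
def LambdaEquation (a b c l : ℝ) : Prop :=
  let u := a * coth (a * l / (a + b + c))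
  let v := b * coth (b * l / (a + b + c))
  let w := c * coth (c * l / (a + b + c))
  √((u ^ 2 - a ^ 2) * (a ^ 2 - (v - w) ^ 2)) + √((v ^ 2 - b ^ 2) * (b ^ 2 - (w - u) ^ 2))
      + √((w ^ 2 - c ^ 2) * (c ^ 2 - (u - v) ^ 2))
    = √(2 * (a ^ 2 * b ^ 2 + b ^ 2 * c ^ 2 + c ^ 2 * a ^ 2) - (a ^ 4 + b ^ 4 + c ^ 4))

/-- A choice of positive solution of the equation (there is exactly one if `a, b, c` are the
sides of a triangle). -/
noncomputable def lambdaMax (a b c : ℝ) : ℝ :=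
  Classical.epsilon fun l : ℝ => 0 < l ∧ LambdaEquation a b c l

/-- The function `f(a,b,c) = √((coth²(aλ/(a+b+c)) - 1)
  (a² - (b coth(bλ/(a+b+c)) - c coth(cλ/(a+b+c)))²))`, where `λ = λ_max(a,b,c)`. -/
noncomputable def centerFunction (a b c : ℝ) : ℝ :=
  √((coth (a * lambdaMax a b c / (a + b + c)) ^ 2 - 1) *
    (a ^ 2 - (b * coth (b * lambdaMax a b c / (a + b + c))
      - c * coth (c * lambdaMax a b c / (a + b + c))) ^ 2))

end ElectrostaticCenter

/-!
The potential `V` is finite and continuous, because `1 / |z|` is locally integrable in the plane and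
the boundary of a convex set is null (`continuous_potential`). Passing from an exterior point to the
nearest point of the triangle increases `V`, so `V` attains its maximum, and only at points of the
triangle (`exists_isMaxPotentialPoint`, `IsMaxPotentialPoint.mem_closedInterior`).

Let `P` be a maximum point. Translating `P` parallel to the side `BC` amounts to translating the
triangle, which gains a strip along one of the sides `AB`, `AC` and loses a strip along the other.
As the potential does not grow, the potential at `P` of the side `AB`, carrying unit charge, is at
most that of `AC`, provided that `P` is not on `AC` (`IsMaxPotentialPoint.segmentPotential_le`).
Everything here is valued in `[0, ∞]`, so the point `P` may lie on `AB`; but then the potential of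
`AB` is infinite and that of `AC` is finite, a contradiction. Hence a maximum point on one side
would lie on all three, which is absurd: `P` is an interior point, and by symmetry the three unit
charges on the sides have the same potential `2t` at `P`.

The potential of a unit charge on `BC` is `(1/a) log ((σ + a) / (σ - a))` with `σ = |PB| + |PC|`
(`segmentPotential_eq`), so the condition reads `|PB| + |PC| = a coth (a t)`, and likewise for the
other sides (`HasParameter`). By Heron's formula for the triangles `PBC`, `PCA`, `PAB`, whose areas
add up to that of `ABC`, the number `λ = (a + b + c) t` solves the equation in the statement
(`HasParameter.heronTerm_sum`), and the summands of the equation are, up to a factor, the directed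
distances from `P` to the side lines, multiplied by the side lengths (`HasParameter.heronTerm_eq`).

Each summand of the equation is strictly decreasing in `λ`, because `a / sinh (a t)` decreases
and `|b coth (b t) - c coth (c t)|`, which is at most `|b - c| < a`, does not decrease as `t` grows
(`heronTerm_strictAntiOn`). With the limits `∞` at `0` and `0` at `∞` this gives exactly one
solution. The solution determines the distances from `P` to the vertices, hence `P`, so that the
uniqueness of the maximum point is a consequence.
-/

namespace ElectrostaticCenter

open MeasureTheory Filter Topology Set

/-! ### Monotonicity of hyperbolic functions -/

lemma sinh_mul_le {s z : ℝ} (hs0 : 0 ≤ s) (hs1 : s ≤ 1) (hz : 0 ≤ z) :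
    Real.sinh (s * z) ≤ s * Real.sinh z := by
  have hconv : ConvexOn ℝ (Set.Ici (0 : ℝ)) Real.sinh := by
    refine MonotoneOn.convexOn_of_deriv (convex_Ici 0) Real.continuous_sinh.continuousOn
      Real.differentiable_sinh.differentiableOn ?_
    intro x hx y hy hxy
    rw [interior_Ici, Set.mem_Ioi] at hx hy
    rw [Real.deriv_sinh, Real.cosh_le_cosh, abs_of_pos hx, abs_of_pos hy]
    exact hxy
  simpa using hconv.2 (Set.mem_Ici.2 hz) (Set.mem_Ici.2 le_rfl) hs0 (sub_nonneg.2 hs1)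
    (by ring)

lemma hasDerivAt_coth {x : ℝ} (hx : 0 < x) :
    HasDerivAt coth (-(1 / Real.sinh x ^ 2)) x := by
  have hs : Real.sinh x ≠ 0 := (Real.sinh_pos_iff.2 hx).ne'
  refine ((Real.hasDerivAt_cosh x).div (Real.hasDerivAt_sinh x) hs).congr_deriv ?_
  have := Real.cosh_sq x
  field_simp
  linarith

lemma coth_sq_sub_one {x : ℝ} (hx : 0 < x) : coth x ^ 2 - 1 = 1 / Real.sinh x ^ 2 := by
  have hs : Real.sinh x ≠ 0 := (Real.sinh_pos_iff.2 hx).ne'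
  have := Real.cosh_sq x
  rw [coth]
  field_simp
  linarith

lemma hasDerivAt_mul_coth {x : ℝ} (hx : 0 < x) :
    HasDerivAt (fun z => z * coth z)
      ((Real.sinh x * Real.cosh x - x) / Real.sinh x ^ 2) x := by
  have hs : Real.sinh x ≠ 0 := (Real.sinh_pos_iff.2 hx).ne'
  refine ((hasDerivAt_id x).mul (hasDerivAt_coth hx)).congr_deriv ?_
  simp only [id, coth]
  field_simp
  ring

lemma mul_coth_monotoneOn : MonotoneOn (fun z => z * coth z) (Set.Ioi 0) := by
  refine monotoneOn_of_deriv_nonneg (convex_Ioi 0)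
    (fun x hx => (hasDerivAt_mul_coth hx).continuousAt.continuousWithinAt)
    (fun x hx => (hasDerivAt_mul_coth (interior_subset hx)).differentiableAt.differentiableWithinAt)
    (fun x hx => ?_)
  have hx : 0 < x := interior_subset hx
  rw [(hasDerivAt_mul_coth hx).deriv]
  have h1 := Real.self_le_sinh_iff.2 hx.le
  have h2 := Real.one_le_cosh x
  refine div_nonneg ?_ (sq_nonneg _)
  nlinarith

lemma sub_mul_coth_monotoneOn : MonotoneOn (fun z => z - z * coth z) (Set.Ioi 0) := by
  have hd : ∀ x : ℝ, 0 < x → HasDerivAt (fun z => z - z * coth z)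
      (1 - (Real.sinh x * Real.cosh x - x) / Real.sinh x ^ 2) x :=
    fun x hx => (hasDerivAt_id x).sub (hasDerivAt_mul_coth hx)
  refine monotoneOn_of_deriv_nonneg (convex_Ioi 0)
    (fun x hx => (hd x hx).continuousAt.continuousWithinAt)
    (fun x hx => (hd x (interior_subset hx)).differentiableAt.differentiableWithinAt)
    (fun x hx => ?_)
  have hx : 0 < x := interior_subset hx
  rw [(hd x hx).deriv, sub_nonneg, div_le_one (pow_pos (Real.sinh_pos_iff.2 hx) 2)]
  -- the claim reads `sinh x * exp (-x) ≤ x`, that is, `1 - exp (-2 x) ≤ 2 x`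
  have h1 : Real.sinh x * (Real.cosh x - Real.sinh x) = (1 - Real.exp (-(2 * x))) / 2 := by
    rw [Real.cosh_sub_sinh, Real.sinh_eq]
    have e1 : Real.exp x * Real.exp (-x) = 1 := by rw [← Real.exp_add]; simp
    have e2 : Real.exp (-x) * Real.exp (-x) = Real.exp (-(2 * x)) := by
      rw [← Real.exp_add]; ring_nf
    linear_combination (1 / 2) * e1 - (1 / 2) * e2
  have h2 := Real.add_one_le_exp (-(2 * x))
  nlinarith

/-! ### The equation for the parameter -/

/-- For `b, c, t > 0` the function `x ↦ x coth (x t)` is nondecreasing and `1`-Lipschitz, so the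
differences in the equation never make a radicand negative. -/
lemma abs_mul_coth_sub_le {b c t : ℝ} (hb : 0 < b) (hc : 0 < c) (ht : 0 < t) :
    |b * coth (b * t) - c * coth (c * t)| ≤ |b - c| := by
  wlog h : c ≤ b generalizing b c
  · rw [abs_sub_comm, abs_sub_comm b]
    exact this hc hb (le_of_not_ge h)
  have hbt := mul_pos hb ht
  have hct := mul_pos hc ht
  have hle : c * t ≤ b * t := by gcongr
  have h1 := mul_coth_monotoneOn (Set.mem_Ioi.2 hct) (Set.mem_Ioi.2 hbt) hle
  have h2 := sub_mul_coth_monotoneOn (Set.mem_Ioi.2 hct) (Set.mem_Ioi.2 hbt) hle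
  simp only at h1 h2
  have h3 : 0 ≤ b * coth (b * t) - c * coth (c * t) := by
    refine nonneg_of_mul_nonneg_left (b := t) ?_ ht
    linarith
  rw [abs_of_nonneg h3, abs_of_nonneg (sub_nonneg.2 h)]
  refine le_of_mul_le_mul_right ?_ ht
  linarith

lemma abs_mul_coth_sub_monotoneOn {b c : ℝ} (hb : 0 < b) (hc : 0 < c) :
    MonotoneOn (fun t => |b * coth (b * t) - c * coth (c * t)|) (Set.Ioi 0) := by
  wlog h : c ≤ b generalizing b c
  · simpa only [abs_sub_comm] using this hc hb (le_of_not_ge h)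
  have hnn : ∀ t : ℝ, 0 < t → 0 ≤ b * coth (b * t) - c * coth (c * t) := fun t ht => by
    have h1 := mul_coth_monotoneOn (Set.mem_Ioi.2 (mul_pos hc ht)) (Set.mem_Ioi.2 (mul_pos hb ht))
      (by gcongr)
    refine nonneg_of_mul_nonneg_left (b := t) ?_ ht
    simp only at h1
    linarith
  have hd1 : ∀ x t : ℝ, 0 < x → 0 < t →
      HasDerivAt (fun t => x * coth (x * t)) (-(x / Real.sinh (x * t)) ^ 2) t :=
    fun x t hx ht => by
      have := ((hasDerivAt_coth (mul_pos hx ht)).comp t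
        ((hasDerivAt_id t).const_mul x)).const_mul x
      refine this.congr_deriv ?_
      ring
  have hd : ∀ t : ℝ, 0 < t → HasDerivAt (fun t => b * coth (b * t) - c * coth (c * t))
      (-(b / Real.sinh (b * t)) ^ 2 - -(c / Real.sinh (c * t)) ^ 2) t :=
    fun t ht => (hd1 b t hb ht).sub (hd1 c t hc ht)
  have hmono : MonotoneOn (fun t => b * coth (b * t) - c * coth (c * t)) (Set.Ioi 0) := by
    refine monotoneOn_of_deriv_nonneg (convex_Ioi 0)
      (fun x hx => (hd x hx).continuousAt.continuousWithinAt)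
      (fun x hx => (hd x (interior_subset hx)).differentiableAt.differentiableWithinAt)
      (fun t ht => ?_)
    have ht : 0 < t := interior_subset ht
    have hsb := Real.sinh_pos_iff.2 (mul_pos hb ht)
    have hsc := Real.sinh_pos_iff.2 (mul_pos hc ht)
    rw [(hd t ht).deriv]
    have h1 : b / Real.sinh (b * t) ≤ c / Real.sinh (c * t) := by
      rw [div_le_div_iff₀ hsb hsc]
      have h2 := sinh_mul_le (div_nonneg hc.le hb.le) ((div_le_one hb).2 h) (mul_pos hb ht).le
      rw [show c / b * (b * t) = c * t by field_simp] at h2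
      calc b * Real.sinh (c * t) ≤ b * (c / b * Real.sinh (b * t)) := by gcongr
        _ = c * Real.sinh (b * t) := by field_simp
    have h3 : 0 ≤ b / Real.sinh (b * t) := by positivity
    nlinarith
  intro s hs t ht hst
  simp only
  rw [abs_of_nonneg (hnn s hs), abs_of_nonneg (hnn t ht)]
  exact hmono hs ht hst

/-- A summand of the left-hand side of the equation, at `t = l / (a + b + c)`. -/
noncomputable def heronTerm (a b c t : ℝ) : ℝ :=
  √(((a * coth (a * t)) ^ 2 - a ^ 2) * (a ^ 2 - (b * coth (b * t) - c * coth (c * t)) ^ 2))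

lemma sq_mul_coth_sub_sq {a t : ℝ} (ha : 0 < a) (ht : 0 < t) :
    (a * coth (a * t)) ^ 2 - a ^ 2 = (a / Real.sinh (a * t)) ^ 2 := by
  have := coth_sq_sub_one (mul_pos ha ht)
  rw [div_pow]
  linear_combination a ^ 2 * this

lemma heronTerm_eq {a b c t : ℝ} (ha : 0 < a) (ht : 0 < t) :
    heronTerm a b c t = a / Real.sinh (a * t) *
      √(a ^ 2 - (b * coth (b * t) - c * coth (c * t)) ^ 2) := by
  have hs := Real.sinh_pos_iff.2 (mul_pos ha ht)
  rw [heronTerm, sq_mul_coth_sub_sq ha ht, Real.sqrt_mul (sq_nonneg _),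
    Real.sqrt_sq (by positivity)]

lemma sq_mul_coth_sub_lt {a b c t : ℝ} (h : IsTriangleSides a b c) (ht : 0 < t) :
    (b * coth (b * t) - c * coth (c * t)) ^ 2 < a ^ 2 := by
  obtain ⟨ha, hb, hc, h1, h2, h3⟩ := h
  refine sq_lt_sq' ?_ ?_ <;>
  · have := abs_le.1 (abs_mul_coth_sub_le hb hc ht)
    have h4 : |b - c| < a := abs_lt.2 ⟨by linarith, by linarith⟩
    linarith [this.1, this.2]

lemma heronTerm_strictAntiOn {a b c : ℝ} (h : IsTriangleSides a b c) :
    StrictAntiOn (heronTerm a b c) (Set.Ioi 0) := by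
  intro s hs t ht hst
  rw [Set.mem_Ioi] at hs ht
  obtain ⟨ha, hb, hc, -⟩ := id h
  rw [heronTerm_eq ha hs, heronTerm_eq ha ht]
  have hss := Real.sinh_pos_iff.2 (mul_pos ha hs)
  have hlt : Real.sinh (a * s) < Real.sinh (a * t) := Real.sinh_lt_sinh.2 (by gcongr)
  have h1 : a / Real.sinh (a * t) < a / Real.sinh (a * s) := by gcongr
  have h2 : √(a ^ 2 - (b * coth (b * t) - c * coth (c * t)) ^ 2) ≤
      √(a ^ 2 - (b * coth (b * s) - c * coth (c * s)) ^ 2) := by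
    refine Real.sqrt_le_sqrt (sub_le_sub_left ?_ _)
    exact sq_le_sq.2 (abs_mul_coth_sub_monotoneOn hb hc hs ht hst.le)
  have h3 : 0 < √(a ^ 2 - (b * coth (b * t) - c * coth (c * t)) ^ 2) :=
    Real.sqrt_pos.2 (sub_pos.2 (sq_mul_coth_sub_lt h ht))
  have h4 : 0 < a / Real.sinh (a * s) := by positivity
  calc _ < a / Real.sinh (a * s) * √(a ^ 2 - (b * coth (b * t) - c * coth (c * t)) ^ 2) := by
        gcongr
    _ ≤ _ := by gcongr

lemma heronTerm_continuousOn {a b c : ℝ} (h : IsTriangleSides a b c) :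
    ContinuousOn (heronTerm a b c) (Set.Ioi 0) := by
  obtain ⟨ha, hb, hc, -⟩ := h
  have hx : ∀ x : ℝ, 0 < x → ContinuousOn (fun t => coth (x * t)) (Set.Ioi 0) :=
    fun x hx t ht => ((hasDerivAt_coth (mul_pos hx ht)).continuousAt.comp
      (continuous_const_mul x).continuousAt).continuousWithinAt
  have := hx a ha
  have := hx b hb
  have := hx c hc
  unfold heronTerm
  fun_prop

lemma heronTerm_le {a b c t : ℝ} (ha : 0 < a) (ht : 0 < t) : heronTerm a b c t ≤ a / t := by
  have hs := Real.sinh_pos_iff.2 (mul_pos ha ht)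
  rw [heronTerm_eq ha ht]
  have h1 : √(a ^ 2 - (b * coth (b * t) - c * coth (c * t)) ^ 2) ≤ a := by
    rw [Real.sqrt_le_left ha.le]
    linarith [sq_nonneg (b * coth (b * t) - c * coth (c * t))]
  have h2 : a * t ≤ Real.sinh (a * t) := Real.self_le_sinh_iff.2 (by positivity)
  calc _ ≤ a / (a * t) * a := by gcongr
    _ = a / t := by field_simp

/-- The terms of the equation tend to infinity as `t → 0`. -/
lemma exists_le_heronTerm {a b c : ℝ} (h : IsTriangleSides a b c) {M : ℝ} (hM : 0 < M) :
    ∃ t : ℝ, 0 < t ∧ M ≤ heronTerm a b c t := by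
  obtain ⟨ha, hb, hc, h1, h2, h3⟩ := id h
  have hd : 0 < a ^ 2 - (b - c) ^ 2 := by nlinarith
  have hd' := Real.sqrt_pos.2 hd
  -- chosen so that the lower bound `a / sinh (a t) * √(a² - (b - c)²)` equals `M`
  let z := Real.arsinh (a * √(a ^ 2 - (b - c) ^ 2) / M)
  have hz : 0 < z := Real.arsinh_pos_iff.2 (by positivity)
  have ht : 0 < z / a := by positivity
  refine ⟨z / a, ht, ?_⟩
  have hza : a * (z / a) = z := by field_simp
  have h4 : √(a ^ 2 - (b - c) ^ 2) ≤
      √(a ^ 2 - (b * coth (b * (z / a)) - c * coth (c * (z / a))) ^ 2) :=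
    Real.sqrt_le_sqrt (sub_le_sub_left (sq_le_sq.2 (abs_mul_coth_sub_le hb hc ht)) _)
  have hs : Real.sinh z = a * √(a ^ 2 - (b - c) ^ 2) / M := Real.sinh_arsinh _
  calc M = a / Real.sinh z * √(a ^ 2 - (b - c) ^ 2) := by rw [hs]; field_simp
    _ ≤ a / Real.sinh z * √(a ^ 2 - (b * coth (b * (z / a)) - c * coth (c * (z / a))) ^ 2) := by
        have : 0 < Real.sinh z := Real.sinh_pos_iff.2 hz
        gcongr
    _ = _ := by rw [heronTerm_eq ha ht, hza]

/-- Sixteen times the squared area of the triangle with sides `a`, `b`, `c` (Heron's formula). -/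
def heronSq (a b c : ℝ) : ℝ :=
  2 * (a ^ 2 * b ^ 2 + b ^ 2 * c ^ 2 + c ^ 2 * a ^ 2) - (a ^ 4 + b ^ 4 + c ^ 4)

lemma heronSq_pos {a b c : ℝ} (h : IsTriangleSides a b c) : 0 < heronSq a b c := by
  obtain ⟨ha, hb, hc, h1, h2, h3⟩ := h
  have : heronSq a b c = (a + b + c) * (b + c - a) * (c + a - b) * (a + b - c) := by
    unfold heronSq; ring
  rw [this]
  have := sub_pos.2 h1
  have := sub_pos.2 h2
  have := sub_pos.2 h3
  positivity

lemma IsTriangleSides.rotate {a b c : ℝ} (h : IsTriangleSides a b c) : IsTriangleSides b c a := by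
  obtain ⟨ha, hb, hc, h1, h2, h3⟩ := h
  exact ⟨hb, hc, ha, h2, h3, h1⟩

lemma IsTriangleSides.swap {a b c : ℝ} (h : IsTriangleSides a b c) : IsTriangleSides a c b := by
  obtain ⟨ha, hb, hc, h1, h2, h3⟩ := h
  exact ⟨ha, hc, hb, by linarith, by linarith, by linarith⟩

lemma IsTriangleSides.scale {a b c t : ℝ} (h : IsTriangleSides a b c) (ht : 0 < t) :
    IsTriangleSides (t * a) (t * b) (t * c) := by
  obtain ⟨ha, hb, hc, h1, h2, h3⟩ := h
  refine ⟨by positivity, by positivity, by positivity, ?_, ?_, ?_⟩ <;> rw [← mul_add] <;> gcongr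

lemma lambdaEquation_iff {a b c l : ℝ} : LambdaEquation a b c l ↔
    heronTerm a b c (l / (a + b + c)) + heronTerm b c a (l / (a + b + c)) +
      heronTerm c a b (l / (a + b + c)) = √(heronSq a b c) := by
  simp only [LambdaEquation, heronTerm, heronSq, mul_div_assoc]

lemma existsUnique_heronTerm_sum_eq {a b c : ℝ} (h : IsTriangleSides a b c) :
    ∃! t : ℝ, 0 < t ∧
      heronTerm a b c t + heronTerm b c a t + heronTerm c a b t = √(heronSq a b c) := by
  obtain ⟨ha, hb, hc, -⟩ := id h
  set G : ℝ → ℝ := fun t => heronTerm a b c t + heronTerm b c a t + heronTerm c a b t with hG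
  set R := √(heronSq a b c) with hR
  have hR0 : 0 < R := Real.sqrt_pos.2 (heronSq_pos h)
  have hanti : StrictAntiOn G (Set.Ioi 0) :=
    ((heronTerm_strictAntiOn h).add (heronTerm_strictAntiOn h.rotate)).add
      (heronTerm_strictAntiOn h.rotate.rotate)
  have hcont : ContinuousOn G (Set.Ioi 0) :=
    ((heronTerm_continuousOn h).add (heronTerm_continuousOn h.rotate)).add
      (heronTerm_continuousOn h.rotate.rotate)
  obtain ⟨t₀, ht₀, hM⟩ := exists_le_heronTerm h hR0
  have ht₁ : 0 < (a + b + c) / R := by positivity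
  have hG0 : R ≤ G t₀ := by
    have h2 : 0 ≤ heronTerm b c a t₀ := Real.sqrt_nonneg _
    have h3 : 0 ≤ heronTerm c a b t₀ := Real.sqrt_nonneg _
    simp only [hG]
    linarith
  have hG1 : G ((a + b + c) / R) ≤ R := by
    have h1 := heronTerm_le (b := b) (c := c) ha ht₁
    have h2 := heronTerm_le (b := c) (c := a) hb ht₁
    have h3 := heronTerm_le (b := a) (c := b) hc ht₁
    have h4 : a / ((a + b + c) / R) + b / ((a + b + c) / R) + c / ((a + b + c) / R) = R := by
      field_simp
    simp only [hG]
    linarith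
  have hsub : Set.uIcc ((a + b + c) / R) t₀ ⊆ Set.Ioi 0 := fun x hx =>
    lt_of_lt_of_le (lt_min ht₁ ht₀) hx.1
  obtain ⟨t, ht, hGt⟩ := intermediate_value_uIcc (hcont.mono hsub)
    (Set.mem_uIcc.2 (.inl ⟨hG1, hG0⟩))
  exact ⟨t, ⟨hsub ht, hGt⟩, fun s hs => hanti.injOn hs.1 (hsub ht) (hs.2.trans hGt.symm)⟩

lemma existsUnique_lambdaEquation {a b c : ℝ} (h : IsTriangleSides a b c) :
    ∃! l : ℝ, 0 < l ∧ LambdaEquation a b c l := by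
  obtain ⟨ha, hb, hc, -⟩ := id h
  have hp : 0 < a + b + c := by positivity
  obtain ⟨t, ⟨ht, hGt⟩, huniq⟩ := existsUnique_heronTerm_sum_eq h
  refine ⟨t * (a + b + c), ⟨by positivity, ?_⟩, fun l hl => ?_⟩
  · rw [lambdaEquation_iff, mul_div_cancel_right₀ _ hp.ne']
    exact hGt
  · rw [← huniq _ ⟨div_pos hl.1 hp, lambdaEquation_iff.1 hl.2⟩, div_mul_cancel₀ _ hp.ne']

lemma lambdaMax_spec {a b c : ℝ} (h : IsTriangleSides a b c) :
    0 < lambdaMax a b c ∧ LambdaEquation a b c (lambdaMax a b c) :=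
  Classical.epsilon_spec (existsUnique_lambdaEquation h).exists

lemma eq_lambdaMax {a b c l : ℝ} (h : IsTriangleSides a b c) (hl : 0 < l)
    (hl' : LambdaEquation a b c l) : l = lambdaMax a b c :=
  (existsUnique_lambdaEquation h).unique ⟨hl, hl'⟩ (lambdaMax_spec h)

/-! ### Symmetry and homogeneity of the center function -/

lemma heronTerm_swap (a b c t : ℝ) : heronTerm a c b t = heronTerm a b c t := by
  rw [heronTerm, heronTerm, sub_sq_comm]

lemma lambdaMax_swap {a b c : ℝ} (h : IsTriangleSides a b c) :
    lambdaMax a c b = lambdaMax a b c := by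
  obtain ⟨h1, h2⟩ := lambdaMax_spec h.swap
  refine eq_lambdaMax h h1 ?_
  rw [lambdaEquation_iff] at h2 ⊢
  rw [show heronSq a b c = heronSq a c b by unfold heronSq; ring, ← h2,
    show a + b + c = a + c + b by ring, heronTerm_swap a b c, heronTerm_swap b c a,
    heronTerm_swap c a b]
  ring

lemma heronTerm_scale (a b c : ℝ) {t s : ℝ} (ht : 0 < t) :
    heronTerm (t * a) (t * b) (t * c) (s / t) = t ^ 2 * heronTerm a b c s := by
  have h : ∀ x : ℝ, t * x * (s / t) = x * s := fun x => by field_simp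
  simp only [heronTerm, h]
  rw [← Real.sqrt_sq (sq_nonneg t), ← Real.sqrt_mul (sq_nonneg _)]
  congr 1
  ring

lemma lambdaMax_scale {a b c t : ℝ} (h : IsTriangleSides a b c) (ht : 0 < t) :
    lambdaMax (t * a) (t * b) (t * c) = lambdaMax a b c := by
  obtain ⟨h1, h2⟩ := lambdaMax_spec h
  refine (eq_lambdaMax (h.scale ht) h1 ?_).symm
  rw [lambdaEquation_iff] at h2 ⊢
  rw [show lambdaMax a b c / (t * a + t * b + t * c) = lambdaMax a b c / (a + b + c) / t by
    rw [← mul_add, ← mul_add, div_div, mul_comm t], heronTerm_scale _ _ _ ht,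
    heronTerm_scale _ _ _ ht, heronTerm_scale _ _ _ ht,
    show heronSq (t * a) (t * b) (t * c) = (t ^ 2) ^ 2 * heronSq a b c by unfold heronSq; ring,
    Real.sqrt_mul (sq_nonneg _), Real.sqrt_sq (sq_nonneg t), ← h2]
  ring

lemma mul_centerFunction {a b c : ℝ} (ha : 0 < a) :
    a * centerFunction a b c = heronTerm a b c (lambdaMax a b c / (a + b + c)) := by
  rw [centerFunction, heronTerm]
  nth_rewrite 1 [← Real.sqrt_sq ha.le]
  rw [← Real.sqrt_mul (sq_nonneg a)]
  simp only [mul_div_assoc]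
  congr 1
  ring

lemma centerFunction_homogeneous : HomogeneousOfOrder centerFunction 1 := by
  intro a b c h t ht
  have ha := h.1
  refine mul_left_cancel₀ (mul_pos ht ha).ne' ?_
  rw [mul_centerFunction (mul_pos ht ha), lambdaMax_scale h ht, ← mul_add, ← mul_add,
    mul_comm t (a + b + c), ← div_div, heronTerm_scale _ _ _ ht, ← mul_centerFunction ha,
    Real.rpow_one]
  ring

lemma centerFunction_symmetric : SymmetricInLastTwo centerFunction := by
  intro a b c h
  refine mul_left_cancel₀ h.1.ne' ?_
  rw [mul_centerFunction h.1, mul_centerFunction h.1, lambdaMax_swap h, heronTerm_swap,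
    add_right_comm]

lemma centerFunction_pos {a b c : ℝ} (h : IsTriangleSides a b c) : 0 < centerFunction a b c := by
  obtain ⟨ha, hb, hc, -⟩ := id h
  have ht : 0 < lambdaMax a b c / (a + b + c) := div_pos (lambdaMax_spec h).1 (by positivity)
  refine pos_of_mul_pos_right ?_ ha.le
  rw [mul_centerFunction ha, heronTerm_eq ha ht]
  have := Real.sinh_pos_iff.2 (mul_pos ha ht)
  have := Real.sqrt_pos.2 (sub_pos.2 (sq_mul_coth_sub_lt h ht))
  positivity

lemma centerFunction_notIdenticallyZero : NotIdenticallyZero centerFunction := by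
  have h : IsTriangleSides 1 1 1 := by unfold IsTriangleSides; norm_num
  exact ⟨1, 1, 1, h, (centerFunction_pos h).ne'⟩

/-! ### Varying the potential along a side -/

/-- The exchange behind the first variation: translating the interval `[0, y]` by `-ε` gains
`[-ε, 0)` and loses `(y - ε, y]`. -/
lemma lintegral_Icc_translate {k : ℝ → ℝ≥0∞} (hk : Measurable k) {y ε : ℝ} (hy : 0 ≤ y)
    (hε : 0 < ε) :
    (∫⁻ x in Icc 0 y, k (x - ε)) + ∫⁻ x in Ioc (-ε) 0, k (y + x) =
      (∫⁻ x in Icc 0 y, k x) + ∫⁻ x in Ico (-ε) 0, k x := by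
  have h1 : ∫⁻ x in Icc 0 y, k (x - ε) = ∫⁻ x in Icc (-ε) (y - ε), k x := by
    rw [← (measurePreserving_sub_right (volume : Measure ℝ) ε).setLIntegral_comp_preimage
      measurableSet_Icc hk, preimage_sub_const_Icc]
    simp
  have h2 : ∫⁻ x in Ioc (-ε) 0, k (y + x) = ∫⁻ x in Ioc (y - ε) y, k x := by
    rw [← (measurePreserving_add_left (volume : Measure ℝ) y).setLIntegral_comp_preimage
      measurableSet_Ioc hk, preimage_const_add_Ioc]
    simp
  rw [h1, h2, ← lintegral_union measurableSet_Ioc, add_comm, ← lintegral_union measurableSet_Icc,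
    Icc_union_Ioc_eq_Icc (by linarith) (by linarith), Ico_union_Icc_eq_Icc (by linarith) hy]
  · exact Set.disjoint_left.2 fun x hx hx' => by linarith [hx.2, hx'.1]
  · exact Set.disjoint_left.2 fun x hx hx' => by linarith [hx.2, hx'.1]

/-- If the mass of a kernel `k` on the triangle `0 ≤ x ≤ y ≤ 1` does not grow when the triangle is
moved in the negative `x`-direction, then the flux of `k` through the side `x = 0` is at most the
flux through the side `x = y`. The kernel may be infinite on the side `x = 0`. -/
lemma lintegral_side_le_of_translate_le {k : ℝ → ℝ → ℝ≥0∞} (hk : Continuous (Function.uncurry k))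
    (hfin : ∫⁻ y in Icc (0 : ℝ) 1, ∫⁻ x in Icc 0 y, k y x ≠ ∞)
    (hmax : ∀ ε > 0, ∫⁻ y in Icc (0 : ℝ) 1, ∫⁻ x in Icc 0 y, k y (x - ε) ≤
      ∫⁻ y in Icc (0 : ℝ) 1, ∫⁻ x in Icc 0 y, k y x)
    (hdiag : ∀ y ∈ Icc (0 : ℝ) 1, k y y ≠ ∞) :
    ∫⁻ y in Icc (0 : ℝ) 1, k y 0 ≤ ∫⁻ y in Icc (0 : ℝ) 1, k y y := by
  have hkm : ∀ y, Measurable (k y) := fun y => (hk.comp (Continuous.prodMk_right y)).measurable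
  set Φ₁ : ℝ → ℝ≥0∞ := fun x => ∫⁻ y in Icc (0 : ℝ) 1, k y x with hΦ₁
  set Φ₂ : ℝ → ℝ≥0∞ := fun x => ∫⁻ y in Icc (0 : ℝ) 1, k y (y + x) with hΦ₂
  have hc2 : Continuous (Function.uncurry fun y x => k y (y + x)) :=
    hk.comp (continuous_fst.prodMk (continuous_fst.add continuous_snd))
  have hstrip : ∀ ε > 0, ∫⁻ x in Ico (-ε) 0, Φ₁ x ≤ ∫⁻ x in Ioc (-ε) 0, Φ₂ x := by
    intro ε hε
    rw [hΦ₁, hΦ₂, lintegral_lintegral_swap (f := fun x y => k y x)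
        (hk.comp continuous_swap).measurable.aemeasurable,
      lintegral_lintegral_swap (f := fun x y => k y (y + x))
        (hc2.comp continuous_swap).measurable.aemeasurable, ← ENNReal.add_le_add_iff_left hfin]
    have e : (∫⁻ y in Icc (0 : ℝ) 1, ∫⁻ x in Icc 0 y, k y (x - ε)) +
        ∫⁻ y in Icc (0 : ℝ) 1, ∫⁻ x in Ioc (-ε) 0, k y (y + x) =
        (∫⁻ y in Icc (0 : ℝ) 1, ∫⁻ x in Icc 0 y, k y x) +
        ∫⁻ y in Icc (0 : ℝ) 1, ∫⁻ x in Ico (-ε) 0, k y x := by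
      have m1 : Measurable fun y => ∫⁻ x in Ioc (-ε) 0, k y (y + x) :=
        hc2.measurable.lintegral_prod_right'
      have m2 : Measurable fun y => ∫⁻ x in Ico (-ε) 0, k y x :=
        hk.measurable.lintegral_prod_right'
      rw [← lintegral_add_right _ m1, ← lintegral_add_right _ m2]
      exact setLIntegral_congr_fun measurableSet_Icc
        fun y hy => lintegral_Icc_translate (hkm y) hy.1 hε
    calc _ = _ := e.symm
      _ ≤ _ := add_le_add (hmax ε hε) le_rfl
  have hlsc : ∀ r < Φ₁ 0, ∀ᶠ x in 𝓝 (0 : ℝ), r < Φ₁ x := by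
    intro r hr
    refine eventually_lt_of_lt_liminf (hr.trans_le ?_)
    refine le_trans (le_of_eq ?_) (lintegral_liminf_le
      fun x => (hk.comp (Continuous.prodMk_left x)).measurable)
    refine lintegral_congr fun y => Eq.symm ?_
    exact ((hk.comp (Continuous.prodMk_right y)).tendsto 0).liminf_eq
  have hcont : Tendsto Φ₂ (𝓝 0) (𝓝 (Φ₂ 0)) := by
    obtain ⟨y₀, hy₀, hy₀max⟩ := (isCompact_Icc (a := (0 : ℝ)) (b := 1)).exists_isMaxOn
      ⟨0, by simp⟩ (hk.comp (continuous_id.prodMk continuous_id)).continuousOn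
    obtain ⟨M, hM, hM'⟩ := exists_between (lt_top_iff_ne_top.2 (hdiag y₀ hy₀))
    have hev : ∀ᶠ x in 𝓝 (0 : ℝ), ∀ y ∈ Icc (0 : ℝ) 1, k y (y + x) < M := by
      refine (isCompact_Icc (a := (0 : ℝ)) (b := 1)).eventually_forall_of_forall_eventually
        fun y hy => ?_
      have := (hc2.comp continuous_swap).tendsto (0, y)
      refine this.eventually_lt_const ?_
      simp only [Function.comp_apply, Function.uncurry, Prod.swap, add_zero]
      exact (hy₀max hy).trans_lt hM
    refine tendsto_lintegral_filter_of_dominated_convergence (fun _ => M)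
      (Eventually.of_forall fun x => (hc2.comp (Continuous.prodMk_left x)).measurable) ?_ ?_ ?_
    · filter_upwards [hev] with x hx
      exact (ae_restrict_mem measurableSet_Icc).mono fun y hy => (hx y hy).le
    · simp [hM'.ne]
    · exact ae_of_all _ fun y => (hc2.comp (Continuous.prodMk_right y)).tendsto 0
  have hΦ₂0 : Φ₂ 0 = ∫⁻ y in Icc (0 : ℝ) 1, k y y := by simp [hΦ₂]
  rw [← hΦ₂0]
  by_contra! hlt
  obtain ⟨r, hr, hr1⟩ := exists_between hlt
  obtain ⟨s, hs, hs1⟩ := exists_between hr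
  obtain ⟨ε, hε, hball⟩ := Metric.eventually_nhds_iff.1
    ((hlsc r hr1).and (hcont.eventually_lt_const hs))
  have hmem : ∀ x ∈ Icc (-(ε / 2)) 0, r < Φ₁ x ∧ Φ₂ x < s := fun x hx => by
    refine hball ?_
    rw [Real.dist_eq, sub_zero, abs_lt]
    constructor <;> linarith [hx.1, hx.2]
  have hlen : ENNReal.ofReal (ε / 2) ≠ 0 := by simpa using hε
  have h := calc
    r * ENNReal.ofReal (ε / 2) = ∫⁻ _ in Ico (-(ε / 2)) 0, r := by simp
    _ ≤ ∫⁻ x in Ico (-(ε / 2)) 0, Φ₁ x :=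
        setLIntegral_mono' measurableSet_Ico fun x hx => (hmem x ⟨hx.1, hx.2.le⟩).1.le
    _ ≤ ∫⁻ x in Ioc (-(ε / 2)) 0, Φ₂ x := hstrip _ (by positivity)
    _ ≤ ∫⁻ _ in Ioc (-(ε / 2)) 0, s :=
        setLIntegral_mono' measurableSet_Ioc fun x hx => (hmem x ⟨hx.1.le, hx.2⟩).2.le
    _ = s * ENNReal.ofReal (ε / 2) := by simp
  exact absurd ((ENNReal.mul_le_mul_iff_left hlen ENNReal.ofReal_ne_top).1 h) (not_le.2 hs1)

/-! ### Barycentric coordinates and integration over a triangle -/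

lemma affineCombination_three (T : Affine.Triangle ℝ Plane) {w₀ w₁ w₂ : ℝ}
    (h : w₀ + w₁ + w₂ = 1) :
    Finset.univ.affineCombination ℝ T.points ![w₀, w₁, w₂] =
      w₀ • T.points 0 + w₁ • T.points 1 + w₂ • T.points 2 := by
  rw [Finset.affineCombination_eq_linear_combination _ _ _ (by simp [Fin.sum_univ_three, h])]
  simp [Fin.sum_univ_three]

lemma mem_closedInterior_iff (T : Affine.Triangle ℝ Plane) {w₀ w₁ w₂ : ℝ}
    (h : w₀ + w₁ + w₂ = 1) :
    w₀ • T.points 0 + w₁ • T.points 1 + w₂ • T.points 2 ∈ T.closedInterior ↔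
      0 ≤ w₀ ∧ 0 ≤ w₁ ∧ 0 ≤ w₂ := by
  rw [← affineCombination_three T h, Affine.Simplex.affineCombination_mem_closedInterior_iff
    (by simp [Fin.sum_univ_three, h])]
  simp only [Fin.forall_fin_succ, mem_Icc]
  simp
  constructor
  · tauto
  · rintro ⟨h0, h1, h2⟩
    refine ⟨⟨h0, ?_⟩, ⟨h1, ?_⟩, h2, ?_⟩ <;> linarith

lemma mem_interior_iff (T : Affine.Triangle ℝ Plane) {w₀ w₁ w₂ : ℝ}
    (h : w₀ + w₁ + w₂ = 1) :
    w₀ • T.points 0 + w₁ • T.points 1 + w₂ • T.points 2 ∈ T.interior ↔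
      0 < w₀ ∧ 0 < w₁ ∧ 0 < w₂ := by
  rw [← affineCombination_three T h, Affine.Simplex.affineCombination_mem_interior_iff
    (by simp [Fin.sum_univ_three, h])]
  simp only [Fin.forall_fin_succ, mem_Ioo]
  simp
  constructor
  · tauto
  · rintro ⟨h0, h1, h2⟩
    refine ⟨⟨h0, ?_⟩, ⟨h1, ?_⟩, h2, ?_⟩ <;> linarith

lemma exists_barycentric (T : Affine.Triangle ℝ Plane) {P : Plane} (hP : P ∈ T.closedInterior) :
    ∃ w₀ w₁ w₂ : ℝ, w₀ + w₁ + w₂ = 1 ∧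
      P = w₀ • T.points 0 + w₁ • T.points 1 + w₂ • T.points 2 := by
  obtain ⟨w, hw, -, rfl⟩ := hP
  rw [Fin.sum_univ_three] at hw
  refine ⟨w 0, w 1, w 2, hw, ?_⟩
  rw [← affineCombination_three T hw]
  congr 1
  ext i
  fin_cases i <;> rfl

lemma barycentric_unique (T : Affine.Triangle ℝ Plane) {w₀ w₁ w₂ v₀ v₁ v₂ : ℝ}
    (hw : w₀ + w₁ + w₂ = 1) (hv : v₀ + v₁ + v₂ = 1)
    (h : w₀ • T.points 0 + w₁ • T.points 1 + w₂ • T.points 2 =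
      v₀ • T.points 0 + v₁ • T.points 1 + v₂ • T.points 2) : w₀ = v₀ ∧ w₁ = v₁ ∧ w₂ = v₂ := by
  rw [← affineCombination_three T hw, ← affineCombination_three T hv] at h
  have h4 := (affineIndependent_iff_eq_of_fintype_affineCombination_eq ℝ T.points).1
    T.independent _ _ (by simpa [Fin.sum_univ_three] using hw)
    (by simpa [Fin.sum_univ_three] using hv) h
  exact ⟨congrFun h4 0, congrFun h4 1, congrFun h4 2⟩

lemma linearIndependent_sides (T : Affine.Triangle ℝ Plane) {x y : ℝ}
    (h : y • (T.points 1 - T.points 0) + x • (T.points 2 - T.points 1) = 0) : y = 0 ∧ x = 0 := by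
  obtain ⟨e0, -, e2⟩ := barycentric_unique T (w₀ := 1) (w₁ := 0) (w₂ := 0)
    (v₀ := 1 - y) (v₁ := y - x) (v₂ := x) (by norm_num) (by ring) (by
      rw [← sub_eq_zero, ← neg_eq_zero.2 h]
      module)
  constructor <;> linarith

/-- The linear coordinates `(y, x) ↦ y (B - A) + x (C - B)` of the plane. -/
noncomputable def sideCoordinates (T : Affine.Triangle ℝ Plane) : (ℝ × ℝ) ≃L[ℝ] Plane :=
  (LinearMap.linearEquivOfInjective
    ((LinearMap.toSpanSingleton ℝ Plane (T.points 1 - T.points 0)).coprod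
      (LinearMap.toSpanSingleton ℝ Plane (T.points 2 - T.points 1)))
    ((injective_iff_map_eq_zero _).2 fun p hp => by
      have := linearIndependent_sides T (y := p.1) (x := p.2) (by simpa using hp)
      exact Prod.ext this.1 this.2)
    (by simp)).toContinuousLinearEquiv

lemma sideCoordinates_apply (T : Affine.Triangle ℝ Plane) (p : ℝ × ℝ) :
    sideCoordinates T p =
      p.1 • (T.points 1 - T.points 0) + p.2 • (T.points 2 - T.points 1) := by
  simp [sideCoordinates]

/-- In the coordinates `Q = A + y (B - A) + x (C - B)` the triangle is `0 ≤ x ≤ y ≤ 1`, and the area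
is a constant multiple of `dx dy`. -/
lemma exists_lintegral_closedInterior (T : Affine.Triangle ℝ Plane) :
    ∃ J : ℝ≥0∞, J ≠ 0 ∧ J ≠ ∞ ∧ ∀ g : Plane → ℝ≥0∞, Measurable g →
      ∫⁻ Q in T.closedInterior, g Q = J * ∫⁻ y in Icc (0 : ℝ) 1, ∫⁻ x in Icc 0 y,
        g (T.points 0 + y • (T.points 1 - T.points 0) + x • (T.points 2 - T.points 1)) := by
  set L := sideCoordinates T
  have hmap : (Measure.map L (volume : Measure (ℝ × ℝ))).IsAddHaarMeasure :=
    L.isAddHaarMeasure_map _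
  set J := Measure.addHaarScalarFactor (volume : Measure Plane) (Measure.map L volume)
  have hvol : (volume : Measure Plane) = J • Measure.map L volume :=
    Measure.isAddLeftInvariant_eq_smul _ _
  have hJ : J ≠ 0 := by
    intro h0
    rw [h0, zero_smul] at hvol
    exact (NeZero.ne (volume : Measure Plane)) hvol
  refine ⟨J, by simpa using hJ, by simp, fun g hg => ?_⟩
  have hT : MeasurableSet T.closedInterior := T.isClosed_closedInterior.measurableSet
  have hcoord : ∀ y x : ℝ,
      T.points 0 + y • (T.points 1 - T.points 0) + x • (T.points 2 - T.points 1) ∈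
        T.closedInterior ↔ y ∈ Icc (0 : ℝ) 1 ∧ x ∈ Icc 0 y := by
    intro y x
    rw [show T.points 0 + y • (T.points 1 - T.points 0) + x • (T.points 2 - T.points 1) =
      (1 - y) • T.points 0 + (y - x) • T.points 1 + x • T.points 2 by module,
      mem_closedInterior_iff T (by ring)]
    simp only [mem_Icc]
    constructor
    · rintro ⟨h0, h1, h2⟩
      refine ⟨⟨?_, ?_⟩, ?_, ?_⟩ <;> linarith
    · rintro ⟨⟨h0, h1⟩, h2, h3⟩
      refine ⟨?_, ?_, ?_⟩ <;> linarith
  have hind : Measurable (T.closedInterior.indicator g) := hg.indicator hT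
  calc ∫⁻ Q in T.closedInterior, g Q = ∫⁻ Q, T.closedInterior.indicator g Q :=
        (lintegral_indicator hT g).symm
    _ = ∫⁻ Q, T.closedInterior.indicator g (T.points 0 + Q) :=
        (lintegral_add_left_eq_self _ _).symm
    _ = J * ∫⁻ p : ℝ × ℝ, T.closedInterior.indicator g (T.points 0 + L p) := by
        conv_lhs => rw [hvol]
        rw [lintegral_smul_measure, lintegral_map (by fun_prop) (by fun_prop)]
        rfl
    _ = J * ∫⁻ y, ∫⁻ x, T.closedInterior.indicator g (T.points 0 + L (y, x)) := by
        rw [Measure.volume_eq_prod, lintegral_prod]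
        exact (Measurable.aemeasurable (by fun_prop))
    _ = _ := by
        congr 1
        rw [← lintegral_indicator measurableSet_Icc]
        refine lintegral_congr fun y => ?_
        by_cases hy : y ∈ Icc (0 : ℝ) 1
        · rw [indicator_of_mem hy, ← lintegral_indicator measurableSet_Icc]
          refine lintegral_congr fun x => ?_
          have := hcoord y x
          rw [sideCoordinates_apply, ← add_assoc]
          by_cases hx : x ∈ Icc 0 y
          · rw [indicator_of_mem hx, indicator_of_mem (this.2 ⟨hy, hx⟩)]
          · rw [indicator_of_notMem hx, indicator_of_notMem (fun h => hx (this.1 h).2)]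
        · rw [indicator_of_notMem hy]
          refine (lintegral_congr fun x => ?_).trans lintegral_zero
          rw [sideCoordinates_apply, ← add_assoc]
          exact indicator_of_notMem (fun h => hy ((hcoord y x).1 h).1) _

/-! ### Existence of a maximum potential point -/

lemma lintegral_ball_inv_enorm_ne_top (r : ℝ) :
    ∫⁻ z in Metric.ball (0 : Plane) r, ‖z‖ₑ⁻¹ ≠ ∞ := by
  have h : IntegrableOn (fun z : Plane => (fun s : ℝ => s⁻¹) ‖z‖) (Metric.ball 0 r) := by
    rw [integrableOn_fun_norm_addHaar]
    refine (integrableOn_const (C := (1 : ℝ)) (by simp)).congr_fun (fun s hs => ?_)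
      measurableSet_Ioo
    have : s ≠ 0 := hs.1.ne'
    simp [this]
  have h2 := h.2
  rw [hasFiniteIntegral_iff_enorm] at h2
  refine ne_of_eq_of_ne (lintegral_congr_ae ?_) h2.ne
  refine ae_restrict_of_ae ?_
  filter_upwards [compl_mem_ae_iff.2 (measure_singleton (0 : Plane))] with z hz
  have hz : ‖z‖ ≠ 0 := norm_ne_zero_iff.2 hz
  rw [enorm_inv hz, enorm_norm]

lemma convex_closedInterior (T : Affine.Triangle ℝ Plane) : Convex ℝ T.closedInterior := by
  rw [← Affine.Simplex.convexHull_eq_closedInterior]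
  exact convex_convexHull _ _

lemma potential_eq_lintegral_translate (T : Affine.Triangle ℝ Plane) (P : Plane) :
    potential T P = ∫⁻ z, T.closedInterior.indicator (fun _ => ‖z‖ₑ⁻¹) (P + z) := by
  rw [potential, ← lintegral_indicator T.isClosed_closedInterior.measurableSet,
    ← lintegral_add_left_eq_self _ P]
  refine lintegral_congr fun z => ?_
  simp only [indicator]
  congr 2
  simp [edist_eq_enorm_sub]

lemma continuous_potential (T : Affine.Triangle ℝ Plane) : Continuous (potential T) := by
  refine continuous_iff_continuousAt.2 fun P => ?_
  obtain ⟨r, hr⟩ := T.isCompact_closedInterior.isBounded.subset_ball P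
  have hT : MeasurableSet T.closedInterior := T.isClosed_closedInterior.measurableSet
  have hnull : ∀ᵐ z : Plane, P + z ∉ frontier T.closedInterior :=
    (measurePreserving_add_left (volume : Measure Plane) P).quasiMeasurePreserving.ae
      (compl_mem_ae_iff.2 ((convex_closedInterior T).addHaar_frontier volume))
  rw [ContinuousAt, funext (potential_eq_lintegral_translate T)]
  refine tendsto_lintegral_filter_of_dominated_convergence (l := 𝓝 P)
    ((Metric.ball (0 : Plane) (r + 1)).indicator fun z => ‖z‖ₑ⁻¹) ?_ ?_ ?_ ?_
  · refine Eventually.of_forall fun P' => ?_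
    have : (fun z => T.closedInterior.indicator (fun _ => ‖z‖ₑ⁻¹) (P' + z)) =
        ((fun z => P' + z) ⁻¹' T.closedInterior).indicator fun z => ‖z‖ₑ⁻¹ := rfl
    rw [this]
    exact Measurable.indicator (by fun_prop) (hT.preimage (by fun_prop))
  · filter_upwards [Metric.ball_mem_nhds P one_pos] with P' hP'
    refine ae_of_all _ fun z => ?_
    by_cases hz : P' + z ∈ T.closedInterior
    · have hball : z ∈ Metric.ball (0 : Plane) (r + 1) := by
        have h1 : ‖P' + z - P‖ < r := by simpa [dist_eq_norm] using hr hz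
        have h2 : ‖P - P'‖ < 1 := by rw [norm_sub_rev]; simpa [dist_eq_norm] using hP'
        have h3 := norm_add_le (P' + z - P) (P - P')
        rw [show P' + z - P + (P - P') = z by abel] at h3
        rw [mem_ball_zero_iff]
        linarith
      rw [indicator_of_mem hz, indicator_of_mem hball]
    · rw [indicator_of_notMem hz]
      exact zero_le
  · rw [lintegral_indicator measurableSet_ball]
    exact lintegral_ball_inv_enorm_ne_top _
  · filter_upwards [hnull] with z hz
    have hadd : Tendsto (fun P' : Plane => P' + z) (𝓝 P) (𝓝 (P + z)) :=
      (continuous_add_const z).tendsto P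
    refine tendsto_const_nhds.congr' ?_
    by_cases hin : P + z ∈ T.closedInterior
    · have hint : P + z ∈ interior T.closedInterior := by
        by_contra hni
        exact hz ⟨subset_closure hin, hni⟩
      filter_upwards [hadd.eventually (isOpen_interior.mem_nhds hint)] with P' hP'
      rw [indicator_of_mem hin, indicator_of_mem (interior_subset hP')]
    · filter_upwards [hadd.eventually (T.isClosed_closedInterior.isOpen_compl.mem_nhds hin)]
        with P' hP'
      rw [indicator_of_notMem hin, indicator_of_notMem hP']

lemma potential_ne_top (T : Affine.Triangle ℝ Plane) (P : Plane) : potential T P ≠ ∞ := by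
  obtain ⟨r, hr⟩ := T.isCompact_closedInterior.isBounded.subset_ball P
  rw [potential_eq_lintegral_translate]
  refine ne_top_of_le_ne_top (lintegral_ball_inv_enorm_ne_top r) ?_
  rw [← lintegral_indicator measurableSet_ball]
  refine lintegral_mono fun z => ?_
  by_cases hz : P + z ∈ T.closedInterior
  · have hball : z ∈ Metric.ball (0 : Plane) r := by simpa [dist_eq_norm] using hr hz
    rw [indicator_of_mem hz, indicator_of_mem hball]
  · rw [indicator_of_notMem hz]
    exact zero_le

lemma volume_closedInterior_ne_zero (T : Affine.Triangle ℝ Plane) :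
    volume T.closedInterior ≠ 0 := by
  have hne : (interior T.closedInterior).Nonempty := by
    rw [← Affine.Simplex.convexHull_eq_closedInterior,
      interior_convexHull_nonempty_iff_affineSpan_eq_top]
    exact T.independent.affineSpan_eq_top_iff_card_eq_finrank_add_one.2 (by simp)
  exact (Measure.measure_pos_of_nonempty_interior _ hne).ne'

/-- The point of the triangle nearest to an exterior point `P` is nearer than `P` to every point
of the triangle, hence has larger potential. -/
lemma exists_potential_lt_of_notMem (T : Affine.Triangle ℝ Plane) {P : Plane}
    (hP : P ∉ T.closedInterior) : ∃ P' ∈ T.closedInterior, potential T P < potential T P' := by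
  have hconv := convex_closedInterior T
  obtain ⟨P', hP', hmin⟩ := exists_norm_eq_iInf_of_complete_convex
    ⟨_, T.point_mem_closedInterior 0⟩ T.isCompact_closedInterior.isComplete hconv P
  rw [norm_eq_iInf_iff_real_inner_le_zero hconv hP'] at hmin
  have hlt : ∀ Q ∈ T.closedInterior, dist P' Q < dist P Q := by
    intro Q hQ
    have h1 := hmin Q hQ
    have h2 : 0 < ‖P - P'‖ := norm_pos_iff.2 (sub_ne_zero.2 fun h => hP (h ▸ hP'))
    have h3 := norm_sub_sq_real (P - P') (Q - P')
    rw [show P - P' - (Q - P') = P - Q by abel] at h3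
    rw [dist_eq_norm, dist_eq_norm, norm_sub_rev P' Q]
    refine lt_of_pow_lt_pow_left₀ 2 (norm_nonneg _) ?_
    nlinarith
  refine ⟨P', hP', ?_⟩
  refine lintegral_strict_mono ?_ (by fun_prop) (potential_ne_top T P) ?_
  · rw [Ne, Measure.restrict_eq_zero]
    exact volume_closedInterior_ne_zero T
  · refine (ae_restrict_mem T.isClosed_closedInterior.measurableSet).mono fun Q hQ => ?_
    rw [ENNReal.inv_lt_inv, edist_dist, edist_dist]
    exact (ENNReal.ofReal_lt_ofReal_iff (dist_nonneg.trans_lt (hlt Q hQ))).2 (hlt Q hQ)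

lemma IsMaxPotentialPoint.mem_closedInterior {T : Affine.Triangle ℝ Plane} {P : Plane}
    (hP : IsMaxPotentialPoint T P) : P ∈ T.closedInterior := by
  by_contra h
  obtain ⟨P', -, hlt⟩ := exists_potential_lt_of_notMem T h
  exact (hP P').not_gt hlt

lemma exists_isMaxPotentialPoint (T : Affine.Triangle ℝ Plane) :
    ∃ P, IsMaxPotentialPoint T P := by
  obtain ⟨P, -, hP⟩ := T.isCompact_closedInterior.exists_isMaxOn
    ⟨_, T.point_mem_closedInterior 0⟩ (continuous_potential T).continuousOn
  refine ⟨P, fun Q => ?_⟩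
  by_cases hQ : Q ∈ T.closedInterior
  · exact hP hQ
  · obtain ⟨Q', hQ', hlt⟩ := exists_potential_lt_of_notMem T hQ
    exact hlt.le.trans (hP hQ')

/-! ### First-order conditions at a maximum potential point -/

/-- The potential at `P` of the segment from `X` to `Y` carrying total charge `1`. -/
noncomputable def segmentPotential (P X Y : Plane) : ℝ≥0∞ :=
  ∫⁻ y in Icc (0 : ℝ) 1, (edist P (X + y • (Y - X)))⁻¹

lemma segmentPotential_comm (P X Y : Plane) : segmentPotential P X Y = segmentPotential P Y X := by
  rw [segmentPotential, segmentPotential]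
  have h := (Measure.measurePreserving_sub_left (volume : Measure ℝ) 1).setLIntegral_comp_preimage
    (s := Icc (0 : ℝ) 1) (f := fun y => (edist P (X + y • (Y - X)))⁻¹) measurableSet_Icc
    (by fun_prop)
  rw [← h, preimage_const_sub_Icc]
  norm_num
  refine lintegral_congr fun y => ?_
  congr 2
  module

lemma potential_reindex (T : Affine.Triangle ℝ Plane) (e : Fin 3 ≃ Fin 3) :
    potential (T.reindex e) = potential T := by
  funext P
  rw [potential, potential, Affine.Simplex.closedInterior_reindex]

lemma IsMaxPotentialPoint.reindex {T : Affine.Triangle ℝ Plane} {P : Plane}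
    (hP : IsMaxPotentialPoint T P) (e : Fin 3 ≃ Fin 3) : IsMaxPotentialPoint (T.reindex e) P := by
  intro Q
  rw [potential_reindex]
  exact hP Q

/-- Moving a maximum potential point parallel to `BC` does not increase the potential. The
derivative of the potential in that direction is, up to a positive factor, the difference of the
potentials of the unit charges on `AB` and on `AC`. -/
lemma IsMaxPotentialPoint.segmentPotential_le {T : Affine.Triangle ℝ Plane} {P : Plane}
    (hP : IsMaxPotentialPoint T P) (hAC : P ∉ segment ℝ (T.points 0) (T.points 2)) :
    segmentPotential P (T.points 0) (T.points 1) ≤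
      segmentPotential P (T.points 0) (T.points 2) := by
  obtain ⟨J, hJ0, hJ, hint⟩ := exists_lintegral_closedInterior T
  set A := T.points 0
  set B := T.points 1
  set C := T.points 2
  have hpot : ∀ Q, potential T Q = J * ∫⁻ y in Icc (0 : ℝ) 1, ∫⁻ x in Icc 0 y,
      (edist Q (A + y • (B - A) + x • (C - B)))⁻¹ := fun Q => hint _ (by fun_prop)
  have key := lintegral_side_le_of_translate_le
    (k := fun y x => (edist P (A + y • (B - A) + x • (C - B)))⁻¹)
    (by unfold Function.uncurry; fun_prop) ?_ ?_ ?_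
  · rw [segmentPotential, segmentPotential]
    refine le_of_eq_of_le (lintegral_congr fun y => ?_)
      (key.trans_eq (lintegral_congr fun y => ?_))
    · simp
    · congr 2
      module
  · intro h
    refine potential_ne_top T P ?_
    rw [hpot, h, ENNReal.mul_top hJ0]
  · intro ε hε
    rw [← ENNReal.mul_le_mul_iff_right hJ0 hJ, ← hpot]
    refine le_of_eq_of_le ?_ (hP (P + ε • (C - B)))
    rw [hpot]
    congr 1
    refine lintegral_congr fun y => lintegral_congr fun x => ?_
    rw [edist_eq_enorm_sub, edist_eq_enorm_sub]
    congr 2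
    module
  · intro y hy h
    rw [ENNReal.inv_eq_top, edist_eq_zero] at h
    refine hAC ⟨1 - y, y, sub_nonneg.2 hy.2, hy.1, by ring, ?_⟩
    rw [h]
    module

lemma segmentPotential_eq_top {P X Y : Plane} (hXY : X ≠ Y) (hP : P ∈ segment ℝ X Y) :
    segmentPotential P X Y = ∞ := by
  rw [segment_eq_image'] at hP
  obtain ⟨y₀, hy₀, rfl⟩ := hP
  by_contra hne
  have hc : ‖Y - X‖ₑ ≠ 0 := by simpa [sub_eq_zero] using hXY.symm
  have heq : ∀ y : ℝ, (edist (X + y₀ • (Y - X)) (X + y • (Y - X)))⁻¹ =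
      ‖Y - X‖ₑ⁻¹ * ‖y - y₀‖ₑ⁻¹ := by
    intro y
    rw [edist_eq_enorm_sub, ← enorm_neg,
      show -(X + y₀ • (Y - X) - (X + y • (Y - X))) = (y - y₀) • (Y - X) by module, enorm_smul,
      mul_comm, ENNReal.mul_inv (.inl hc) (.inl enorm_ne_top)]
  simp only [segmentPotential, heq] at hne
  rw [lintegral_const_mul _ (by fun_prop)] at hne
  have hfin : ∫⁻ y in Icc (0 : ℝ) 1, ‖y - y₀‖ₑ⁻¹ ≠ ∞ := fun h =>
    hne (by rw [h, ENNReal.mul_top (ENNReal.inv_ne_zero.2 enorm_ne_top)])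
  have hint : IntegrableOn (fun y : ℝ => (y - y₀)⁻¹) (Icc 0 1) := by
    refine ⟨(Measurable.aestronglyMeasurable (by fun_prop)), ?_⟩
    rw [hasFiniteIntegral_iff_enorm]
    refine lt_of_le_of_lt (lintegral_mono fun y => ?_) (lt_top_iff_ne_top.2 hfin)
    rcases eq_or_ne (y - y₀) 0 with h | h
    · simp [h]
    · rw [enorm_inv h]
  have := intervalIntegrable_sub_inv_iff.1
    ((intervalIntegrable_iff_integrableOn_Icc_of_le zero_le_one).2 hint)
  rcases this with h | h
  · norm_num at h
  · rw [uIcc_of_le zero_le_one] at h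
    exact h hy₀

lemma segmentPotential_ne_top {P X Y : Plane} (hP : P ∉ segment ℝ X Y) :
    segmentPotential P X Y ≠ ∞ := by
  obtain ⟨y₀, hy₀, hmax⟩ := (isCompact_Icc (a := (0 : ℝ)) (b := 1)).exists_isMaxOn
    (f := fun y => (edist P (X + y • (Y - X)))⁻¹) ⟨0, by simp⟩ (by fun_prop)
  have hy₀' : (edist P (X + y₀ • (Y - X)))⁻¹ ≠ ∞ := by
    rw [Ne, ENNReal.inv_eq_top, edist_eq_zero]
    rintro rfl
    exact hP (segment_eq_image' ℝ X Y ▸ ⟨y₀, hy₀, rfl⟩)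
  refine ne_top_of_le_ne_top (b := ∫⁻ _ in Icc (0 : ℝ) 1, (edist P (X + y₀ • (Y - X)))⁻¹)
    (by simpa using hy₀') ?_
  exact setLIntegral_mono' measurableSet_Icc fun y hy => hmax hy

lemma IsMaxPotentialPoint.segmentPotential_le_perm {T : Affine.Triangle ℝ Plane} {P : Plane}
    (hP : IsMaxPotentialPoint T P) (σ : Equiv.Perm (Fin 3))
    (h : P ∉ segment ℝ (T.points (σ 0)) (T.points (σ 2))) :
    segmentPotential P (T.points (σ 0)) (T.points (σ 1)) ≤
      segmentPotential P (T.points (σ 0)) (T.points (σ 2)) := by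
  simpa using (hP.reindex σ.symm).segmentPotential_le (by simpa using h)

/-- A maximum potential point on a side would have infinite potential with respect to that side,
so by the first-order conditions it would lie on the two other sides as well. -/
lemma IsMaxPotentialPoint.mem_segment_perm {T : Affine.Triangle ℝ Plane} {P : Plane}
    (hP : IsMaxPotentialPoint T P) (σ : Equiv.Perm (Fin 3))
    (h : P ∈ segment ℝ (T.points (σ 0)) (T.points (σ 1))) :
    P ∈ segment ℝ (T.points (σ 0)) (T.points (σ 2)) := by
  by_contra h'
  have h1 := hP.segmentPotential_le_perm σ h'
  rw [segmentPotential_eq_top (T.independent.injective.ne (σ.injective.ne (by decide))) h,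
    top_le_iff] at h1
  exact segmentPotential_ne_top h' h1

lemma IsMaxPotentialPoint.notMem_segment {T : Affine.Triangle ℝ Plane} {P : Plane}
    (hP : IsMaxPotentialPoint T P) : P ∉ segment ℝ (T.points 0) (T.points 1) := by
  intro h01
  have h02 : P ∈ segment ℝ (T.points 0) (T.points 2) := hP.mem_segment_perm 1 h01
  have h12 : P ∈ segment ℝ (T.points 1) (T.points 2) :=
    hP.mem_segment_perm (Equiv.swap 0 1) (by simpa [segment_symm] using h01)
  obtain ⟨s, t, -, -, hst, h⟩ := h01
  obtain ⟨s', t', -, -, hst', h'⟩ := h02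
  obtain ⟨s'', t'', -, -, hst'', h''⟩ := h12
  have e1 := barycentric_unique T (w₀ := s) (w₁ := t) (w₂ := 0) (v₀ := s') (v₁ := 0) (v₂ := t')
    (by linarith) (by linarith) (by simpa using h.trans h'.symm)
  have e2 := barycentric_unique T (w₀ := s) (w₁ := t) (w₂ := 0) (v₀ := 0) (v₁ := s'') (v₂ := t'')
    (by linarith) (by linarith) (by simpa using h.trans h''.symm)
  linarith [e1.2.1, e2.1]

lemma IsMaxPotentialPoint.notMem_segment_perm {T : Affine.Triangle ℝ Plane} {P : Plane}
    (hP : IsMaxPotentialPoint T P) (σ : Equiv.Perm (Fin 3)) :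
    P ∉ segment ℝ (T.points (σ 0)) (T.points (σ 1)) := by
  simpa using (hP.reindex σ.symm).notMem_segment

lemma IsMaxPotentialPoint.mem_interior {T : Affine.Triangle ℝ Plane} {P : Plane}
    (hP : IsMaxPotentialPoint T P) : P ∈ T.interior := by
  obtain ⟨w₀, w₁, w₂, hw, h⟩ := exists_barycentric T hP.mem_closedInterior
  have hnn := hP.mem_closedInterior
  rw [h, mem_closedInterior_iff T hw] at hnn
  obtain ⟨h0, h1, h2⟩ := hnn
  rw [h, mem_interior_iff T hw]
  refine ⟨lt_of_le_of_ne h0 ?_, lt_of_le_of_ne h1 ?_, lt_of_le_of_ne h2 ?_⟩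
  · rintro rfl
    refine hP.notMem_segment_perm (finRotate 3) ⟨w₁, w₂, h1, h2, by linarith, ?_⟩
    simp [h]
  · rintro rfl
    refine hP.notMem_segment_perm (Equiv.swap 1 2) ⟨w₀, w₂, h0, h2, by linarith, ?_⟩
    simp [h, Equiv.swap_apply_of_ne_of_ne (a := (1 : Fin 3)) (b := 2) (x := 0)]
  · rintro rfl
    refine hP.notMem_segment ⟨w₀, w₁, h0, h1, by linarith, ?_⟩
    simp [h]

/-- The gradient of the potential vanishes at a maximum potential point: any two sides, carrying
unit charges, have the same potential there. -/
lemma IsMaxPotentialPoint.segmentPotential_perm {T : Affine.Triangle ℝ Plane} {P : Plane}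
    (hP : IsMaxPotentialPoint T P) (σ : Equiv.Perm (Fin 3)) :
    segmentPotential P (T.points (σ 0)) (T.points (σ 1)) =
      segmentPotential P (T.points (σ 0)) (T.points (σ 2)) := by
  have hswap : Equiv.swap (1 : Fin 3) 2 0 = 0 := by decide
  have key : ∀ τ : Equiv.Perm (Fin 3),
      segmentPotential P (T.points (τ 0)) (T.points (τ 1)) ≤
        segmentPotential P (T.points (τ 0)) (T.points (τ 2)) := fun τ =>
    hP.segmentPotential_le_perm τ (by
      simpa [hswap] using hP.notMem_segment_perm ((Equiv.swap 1 2).trans τ))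
  exact le_antisymm (key σ) (by simpa [hswap] using key ((Equiv.swap 1 2).trans σ))

/-! ### The potential of a segment -/

/-- The determinant of two vectors of the plane. -/
def cross (u v : Plane) : ℝ := u 0 * v 1 - u 1 * v 0

lemma dist_sq_eq (X Y : Plane) : dist X Y ^ 2 = (X 0 - Y 0) ^ 2 + (X 1 - Y 1) ^ 2 := by
  rw [EuclideanSpace.dist_eq, Real.sq_sqrt (by positivity), Fin.sum_univ_two, Real.dist_eq,
    Real.dist_eq, sq_abs, sq_abs]

/-- Heron's formula for the triangle `P X Y`. -/
lemma heron_cross (P X Y : Plane) :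
    ((dist P X + dist P Y) ^ 2 - dist X Y ^ 2) * (dist X Y ^ 2 - (dist P X - dist P Y) ^ 2) =
      4 * cross (X - P) (Y - P) ^ 2 := by
  have h1 := dist_sq_eq P X
  have h2 := dist_sq_eq P Y
  have h3 := dist_sq_eq X Y
  have e : ((dist P X + dist P Y) ^ 2 - dist X Y ^ 2) *
      (dist X Y ^ 2 - (dist P X - dist P Y) ^ 2) =
      4 * (dist P X ^ 2 * dist P Y ^ 2) - (dist P X ^ 2 + dist P Y ^ 2 - dist X Y ^ 2) ^ 2 := by
    ring
  rw [e, h1, h2, h3]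
  simp only [cross, PiLp.sub_apply]
  ring

lemma dist_lt_of_cross_ne_zero {P X Y : Plane} (h : cross (X - P) (Y - P) ≠ 0) :
    dist X Y < dist P X + dist P Y := by
  have h1 := heron_cross P X Y
  have h2 := dist_triangle_left X Y P
  refine lt_of_le_of_ne h2 fun he => h ?_
  rw [← he] at h1
  nlinarith

/-- The potential at `P` of a segment of length `a` and unit total charge is
`(1/a) log ((σ + a) / (σ - a))`, where `σ` is the sum of the distances from `P` to its ends. -/
lemma segmentPotential_eq {P X Y : Plane} (h : cross (X - P) (Y - P) ≠ 0) :
    segmentPotential P X Y = ENNReal.ofReal (Real.log ((dist P X + dist P Y + dist X Y) /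
      (dist P X + dist P Y - dist X Y)) / dist X Y) := by
  have hXY : X ≠ Y := by
    rintro rfl
    exact h (by simp only [cross]; ring)
  have ha : 0 < dist X Y := dist_pos.2 hXY
  set a := dist X Y with ha_def
  set R : ℝ → ℝ := fun y => dist P (X + y • (Y - X)) with hR
  set D : ℝ → ℝ := fun y =>
    (X 0 - P 0 + y * (Y 0 - X 0)) * (Y 0 - X 0) + (X 1 - P 1 + y * (Y 1 - X 1)) * (Y 1 - X 1)
    with hD
  have ha2 : a ^ 2 = (X 0 - Y 0) ^ 2 + (X 1 - Y 1) ^ 2 := dist_sq_eq X Y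
  have hR2 : ∀ y, R y ^ 2 =
      (X 0 - P 0 + y * (Y 0 - X 0)) ^ 2 + (X 1 - P 1 + y * (Y 1 - X 1)) ^ 2 := by
    intro y
    simp only [hR, dist_sq_eq, PiLp.add_apply, PiLp.smul_apply, PiLp.sub_apply, smul_eq_mul]
    ring
  have hlag : ∀ y, (a * R y) ^ 2 = D y ^ 2 + cross (X - P) (Y - P) ^ 2 := by
    intro y
    rw [mul_pow, ha2, hR2]
    simp only [hD, cross, PiLp.sub_apply]
    ring
  have hcr : 0 < cross (X - P) (Y - P) ^ 2 := by positivity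
  have hRnn : ∀ y, 0 ≤ R y := fun y => dist_nonneg
  have hpos : ∀ y, 0 < a * R y + D y := by
    intro y
    have h1 : |D y| < a * R y := by
      refine abs_lt_of_sq_lt_sq ?_ (mul_nonneg ha.le (hRnn y))
      linarith [hlag y]
    linarith [(abs_lt.1 h1).1]
  have hRpos : ∀ y, 0 < R y := by
    intro y
    refine lt_of_le_of_ne (hRnn y) fun h0 => ?_
    have := hlag y
    rw [← h0] at this
    nlinarith [sq_nonneg (D y)]
  have hRd : ∀ y, HasDerivAt R (D y / R y) y := by
    intro y
    have hl : ∀ i : Fin 2, HasDerivAt (fun y : ℝ => X i - P i + y * (Y i - X i)) (Y i - X i) y :=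
      fun i => by simpa using ((hasDerivAt_id y).mul_const (Y i - X i)).const_add (X i - P i)
    have h1 := (((hl 0).pow 2).add ((hl 1).pow 2)).sqrt (by
      have := hR2 y
      have h2 := pow_pos (hRpos y) 2
      simp only [Pi.add_apply, Pi.pow_apply]
      linarith)
    have hfun : R = fun y : ℝ => √((X 0 - P 0 + y * (Y 0 - X 0)) ^ 2 +
        (X 1 - P 1 + y * (Y 1 - X 1)) ^ 2) := by
      funext z
      rw [← hR2, Real.sqrt_sq (hRnn z)]
    have h3 : √((X 0 - P 0 + y * (Y 0 - X 0)) ^ 2 + (X 1 - P 1 + y * (Y 1 - X 1)) ^ 2) = R y := by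
      rw [hfun]
    rw [hfun]
    refine h1.congr_deriv ?_
    simp only [Pi.add_apply, Pi.pow_apply]
    rw [h3, hD]
    have := (hRpos y).ne'
    field_simp
    ring
  have hDd : ∀ y, HasDerivAt D (a ^ 2) y := by
    intro y
    have hl : ∀ i : Fin 2, HasDerivAt (fun y : ℝ => X i - P i + y * (Y i - X i)) (Y i - X i) y :=
      fun i => by simpa using ((hasDerivAt_id y).mul_const (Y i - X i)).const_add (X i - P i)
    refine (((hl 0).mul_const _).add ((hl 1).mul_const _)).congr_deriv ?_
    rw [ha2]
    ring
  have hprim : ∀ y, HasDerivAt (fun y => Real.log (a * R y + D y) / a) (R y)⁻¹ y := by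
    intro y
    refine (((((hRd y).const_mul a).add (hDd y)).log (hpos y).ne').div_const a).congr_deriv ?_
    have h1 := (hRpos y).ne'
    have h2 := (hpos y).ne'
    simp only [Pi.add_apply]
    field_simp
    ring
  have hcont : Continuous fun y => (R y)⁻¹ := by
    refine Continuous.inv₀ ?_ fun y => (hRpos y).ne'
    rw [hR]
    fun_prop
  have hint : ∫ y in (0 : ℝ)..1, (R y)⁻¹ =
      Real.log (a * R 1 + D 1) / a - Real.log (a * R 0 + D 0) / a :=
    intervalIntegral.integral_eq_sub_of_hasDerivAt (fun y _ => hprim y)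
      (hcont.intervalIntegrable _ _)
  have hR0 : R 0 = dist P X := by simp [hR]
  have hR1 : R 1 = dist P Y := by simp [hR]
  have hX2 := dist_sq_eq P X
  have hY2 := dist_sq_eq P Y
  have hlt := dist_lt_of_cross_ne_zero h
  rw [segmentPotential]
  calc ∫⁻ y in Icc (0 : ℝ) 1, (edist P (X + y • (Y - X)))⁻¹
      = ∫⁻ y in Icc (0 : ℝ) 1, ENNReal.ofReal (R y)⁻¹ := by
        refine lintegral_congr fun y => ?_
        rw [ENNReal.ofReal_inv_of_pos (hRpos y), edist_dist]
    _ = ENNReal.ofReal (∫ y in Icc (0 : ℝ) 1, (R y)⁻¹) :=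
        (ofReal_integral_eq_lintegral_ofReal (hcont.integrableOn_Icc)
          (ae_of_all _ fun y => inv_nonneg.2 (hRnn y))).symm
    _ = _ := by
        rw [integral_Icc_eq_integral_Ioc, ← intervalIntegral.integral_of_le zero_le_one, hint,
          ← sub_div, ← Real.log_div (hpos 1).ne' (hpos 0).ne']
        congr 3
        rw [div_eq_div_iff (hpos 0).ne' (by linarith), hR0, hR1]
        have e1 : a * dist P Y + D 1 = ((dist P Y + a) ^ 2 - dist P X ^ 2) / 2 := by
          rw [add_sq, ha2, hX2, hY2]
          simp only [hD]
          ring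
        have e0 : a * dist P X + D 0 = (dist P Y ^ 2 - (dist P X - a) ^ 2) / 2 := by
          rw [sub_sq, ha2, hX2, hY2]
          simp only [hD]
          ring
        rw [e0, e1]
        ring

lemma eq_mul_coth_of_log {a σ t : ℝ} (ha : 0 < a) (h : a < σ)
    (ht : Real.log ((σ + a) / (σ - a)) / a = 2 * t) : σ = a * coth (a * t) := by
  have hq : 0 < (σ + a) / (σ - a) := div_pos (by linarith) (by linarith)
  have h1 : Real.exp (a * t) ^ 2 = (σ + a) / (σ - a) := by
    rw [← Real.exp_log hq, ← Real.exp_nat_mul]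
    congr 1
    field_simp at ht
    push_cast
    linarith
  have h2 : 0 < Real.exp (a * t) := Real.exp_pos _
  have h3 : σ - a ≠ 0 := by linarith
  rw [eq_div_iff h3] at h1
  have h4 : Real.exp (a * t) ^ 2 - 1 ≠ 0 := by
    intro h0
    have : Real.exp (a * t) ^ 2 = 1 := by linarith
    rw [this] at h1
    linarith
  rw [coth, Real.cosh_eq, Real.sinh_eq, Real.exp_neg]
  have h5 : Real.exp (a * t) - (Real.exp (a * t))⁻¹ ≠ 0 := by
    intro h0
    apply h4
    field_simp at h0
    linarith
  field_simp
  linarith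

/-! ### Areas and heights -/

lemma cross_sides_ne_zero (T : Affine.Triangle ℝ Plane) :
    cross (T.points 1 - T.points 0) (T.points 2 - T.points 0) ≠ 0 := by
  set A := T.points 0 with hA
  set B := T.points 1 with hB
  set C := T.points 2 with hC
  intro h
  simp only [cross, PiLp.sub_apply] at h
  -- if the determinant vanishes, each row of cofactors is a linear relation between the sides
  have h0 := linearIndependent_sides T (y := C 0 - B 0) (x := -(B 0 - A 0)) (by
    ext i
    fin_cases i
    · simp; ring
    · simp; linear_combination -h)
  have h1 := linearIndependent_sides T (y := C 1 - B 1) (x := -(B 1 - A 1)) (by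
    ext i
    fin_cases i
    · simp; linear_combination h
    · simp; ring)
  have h2 := linearIndependent_sides T (y := 1) (x := 0) (by
    ext i
    fin_cases i
    · simp; linarith [h0.2]
    · simp; linarith [h1.2])
  norm_num at h2

lemma cross_barycentric (A B C : Plane) {w₀ w₁ w₂ : ℝ} (hw : w₀ + w₁ + w₂ = 1) :
    cross (B - (w₀ • A + w₁ • B + w₂ • C)) (C - (w₀ • A + w₁ • B + w₂ • C)) =
      w₀ * cross (B - A) (C - A) := by
  obtain rfl : w₂ = 1 - w₀ - w₁ := by linarith
  simp only [cross, PiLp.sub_apply, PiLp.add_apply, PiLp.smul_apply, smul_eq_mul]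
  ring

/-- Twice the area of a triangle is the length of a side times the corresponding height. -/
lemma dist_mul_signedInfDist_self (T : Affine.Triangle ℝ Plane) :
    dist (T.points 1) (T.points 2) * T.signedInfDist 0 (T.points 0) =
      |cross (T.points 1 - T.points 0) (T.points 2 - T.points 0)| := by
  set A := T.points 0 with hA
  set B := T.points 1 with hB
  set C := T.points 2 with hC
  have himg : T.points '' {0}ᶜ = {B, C} := by
    rw [show ({0}ᶜ : Set (Fin 3)) = {1, 2} by ext i; fin_cases i <;> simp, Set.image_pair]
  have hself : T.signedInfDist 0 A =
      ‖A - EuclideanGeometry.orthogonalProjection (affineSpan ℝ (T.points '' {0}ᶜ)) A‖ :=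
    AffineSubspace.signedInfDist_apply_self _ _
  have hFmem := EuclideanGeometry.orthogonalProjection_mem
    (s := affineSpan ℝ (T.points '' {0}ᶜ)) A
  have horth := EuclideanGeometry.vsub_orthogonalProjection_mem_direction_orthogonal
    (affineSpan ℝ (T.points '' {0}ᶜ)) A
  set F : Plane := ↑(EuclideanGeometry.orthogonalProjection (affineSpan ℝ (T.points '' {0}ᶜ)) A)
    with hF
  have hdir : C - B ∈ (affineSpan ℝ (T.points '' {0}ᶜ)).direction := by
    rw [himg]
    exact AffineSubspace.vsub_mem_direction (right_mem_affineSpan_pair ℝ B C)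
      (left_mem_affineSpan_pair ℝ B C)
  have hperp := (Submodule.mem_orthogonal _ _).1 horth _ hdir
  rw [himg] at hFmem
  obtain ⟨s, hs⟩ := mem_affineSpan_pair_iff_exists_lineMap_eq.1 hFmem
  rw [AffineMap.lineMap_apply] at hs
  simp only [vsub_eq_sub, vadd_eq_add] at hs hperp
  rw [hself, ← dist_eq_norm, ← sq_eq_sq₀ (by positivity) (abs_nonneg _), sq_abs, mul_pow,
    dist_sq_eq, dist_sq_eq]
  have f0 : F 0 = s * (C 0 - B 0) + B 0 := by rw [← hs]; simp
  have f1 : F 1 = s * (C 1 - B 1) + B 1 := by rw [← hs]; simp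
  have hperp' : (C 0 - B 0) * (A 0 - F 0) + (C 1 - B 1) * (A 1 - F 1) = 0 := by
    rw [PiLp.inner_apply, Fin.sum_univ_two] at hperp
    simp at hperp
    linarith
  have hcr : cross (B - A) (C - A) = cross (C - B) (A - F) := by
    simp only [cross, PiLp.sub_apply, f0, f1]
    ring
  rw [hcr]
  simp only [cross, PiLp.sub_apply]
  linear_combination ((C 0 - B 0) * (A 0 - F 0) + (C 1 - B 1) * (A 1 - F 1)) * hperp'

lemma signedInfDist_barycentric (T : Affine.Triangle ℝ Plane) {w₀ w₁ w₂ : ℝ}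
    (hw : w₀ + w₁ + w₂ = 1) :
    T.signedInfDist 0 (w₀ • T.points 0 + w₁ • T.points 1 + w₂ • T.points 2) =
      w₀ * T.signedInfDist 0 (T.points 0) := by
  rw [← affineCombination_three T hw, Affine.Simplex.signedInfDist_affineCombination T 0
    (by simp [Fin.sum_univ_three, hw]), Affine.Simplex.signedInfDist_apply_self]
  rfl

lemma isTriangleSides (T : Affine.Triangle ℝ Plane) :
    IsTriangleSides (sideA T) (sideB T) (sideC T) := by
  have hS := cross_sides_ne_zero T
  have hpos : ∀ i j : Fin 3, i ≠ j → 0 < dist (T.points i) (T.points j) := fun i j hij =>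
    dist_pos.2 (T.independent.injective.ne hij)
  unfold sideA sideB sideC
  refine ⟨hpos _ _ (by decide), hpos _ _ (by decide), hpos _ _ (by decide), ?_, ?_, ?_⟩
  · have := dist_lt_of_cross_ne_zero hS
    rw [dist_comm (T.points 2) (T.points 0)]
    linarith
  · have := dist_lt_of_cross_ne_zero (P := T.points 1) (X := T.points 2) (Y := T.points 0)
      (fun h => hS (by rw [← h]; simp only [cross, PiLp.sub_apply]; ring))
    rw [dist_comm (T.points 1) (T.points 0)] at this
    linarith
  · have := dist_lt_of_cross_ne_zero (P := T.points 2) (X := T.points 0) (Y := T.points 1)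
      (fun h => hS (by rw [← h]; simp only [cross, PiLp.sub_apply]; ring))
    rw [dist_comm (T.points 2) (T.points 1)] at this
    linarith

lemma sqrt_heronSq (T : Affine.Triangle ℝ Plane) :
    √(heronSq (sideA T) (sideB T) (sideC T)) =
      2 * |cross (T.points 1 - T.points 0) (T.points 2 - T.points 0)| := by
  have h := heron_cross (T.points 0) (T.points 1) (T.points 2)
  rw [show heronSq (sideA T) (sideB T) (sideC T) =
      (2 * |cross (T.points 1 - T.points 0) (T.points 2 - T.points 0)|) ^ 2 by
    rw [mul_pow, sq_abs, show (2 : ℝ) ^ 2 = 4 by norm_num, ← h, heronSq, sideA, sideB, sideC,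
      dist_comm (T.points 2) (T.points 0)]
    ring, Real.sqrt_sq (by positivity)]

/-! ### The parameter of a maximum potential point -/

/-- The distances from `P` to the vertices of `T` satisfy `|PB| + |PC| = a coth (a t)` and the two
analogous equations. -/
def HasParameter (T : Affine.Triangle ℝ Plane) (P : Plane) (t : ℝ) : Prop :=
  dist P (T.points 1) + dist P (T.points 2) = sideA T * coth (sideA T * t) ∧
  dist P (T.points 2) + dist P (T.points 0) = sideB T * coth (sideB T * t) ∧
  dist P (T.points 0) + dist P (T.points 1) = sideC T * coth (sideC T * t)

lemma IsMaxPotentialPoint.exists_hasParameter {T : Affine.Triangle ℝ Plane} {P : Plane}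
    (hP : IsMaxPotentialPoint T P) : ∃ t, 0 < t ∧ HasParameter T P t := by
  have hS := cross_sides_ne_zero T
  have hint := hP.mem_interior
  obtain ⟨w₀, w₁, w₂, hw, rfl⟩ := exists_barycentric T hP.mem_closedInterior
  rw [mem_interior_iff T hw] at hint
  obtain ⟨h0, h1, h2⟩ := hint
  set A := T.points 0 with hA
  set B := T.points 1 with hB
  set C := T.points 2 with hC
  set P := w₀ • A + w₁ • B + w₂ • C with hPdef
  have cA : cross (B - P) (C - P) ≠ 0 := by
    rw [hPdef, cross_barycentric A B C hw]
    exact mul_ne_zero h0.ne' hS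
  have cB : cross (C - P) (A - P) ≠ 0 := by
    have e : P = w₁ • B + w₂ • C + w₀ • A := by rw [hPdef]; abel
    rw [e, cross_barycentric B C A (by linarith)]
    refine mul_ne_zero h1.ne' fun h => hS ?_
    rw [← h]
    simp only [cross, PiLp.sub_apply]
    ring
  have cC : cross (A - P) (B - P) ≠ 0 := by
    have e : P = w₂ • C + w₀ • A + w₁ • B := by rw [hPdef]; abel
    rw [e, cross_barycentric C A B (by linarith)]
    refine mul_ne_zero h2.ne' fun h => hS ?_
    rw [← h]
    simp only [cross, PiLp.sub_apply]
    ring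
  obtain ⟨ha, hb, hc, -⟩ := isTriangleSides T
  have key : ∀ {X Y : Plane}, 0 < dist X Y → cross (X - P) (Y - P) ≠ 0 →
      0 < Real.log ((dist P X + dist P Y + dist X Y) / (dist P X + dist P Y - dist X Y)) /
        dist X Y := by
    intro X Y hXY hc
    have hlt := dist_lt_of_cross_ne_zero hc
    refine div_pos (Real.log_pos ?_) hXY
    rw [one_lt_div (by linarith)]
    linarith
  have hAB : segmentPotential P A B = segmentPotential P A C := hP.segmentPotential_perm 1
  have hBA : segmentPotential P B C = segmentPotential P B A :=
    hP.segmentPotential_perm (finRotate 3)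
  rw [segmentPotential_comm P B A] at hBA
  rw [segmentPotential_comm P A C] at hAB
  have e1 := hBA.trans hAB
  rw [segmentPotential_eq cA, segmentPotential_eq cB, ENNReal.ofReal_eq_ofReal_iff
    (key ha cA).le (key hb cB).le] at e1
  have e2 := hAB
  rw [segmentPotential_eq cC, segmentPotential_eq cB, ENNReal.ofReal_eq_ofReal_iff
    (key hc cC).le (key hb cB).le] at e2
  refine ⟨_, half_pos (key hb cB), ?_, ?_, ?_⟩
  · refine eq_mul_coth_of_log ha (dist_lt_of_cross_ne_zero cA) ?_
    rw [mul_div_cancel₀ _ two_ne_zero]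
    exact e1
  · refine eq_mul_coth_of_log hb (dist_lt_of_cross_ne_zero cB) ?_
    rw [mul_div_cancel₀ _ two_ne_zero]
    rfl
  · refine eq_mul_coth_of_log hc (dist_lt_of_cross_ne_zero cC) ?_
    rw [mul_div_cancel₀ _ two_ne_zero]
    exact e2

lemma HasParameter.rotate {T : Affine.Triangle ℝ Plane} {P : Plane} {t : ℝ}
    (h : HasParameter T P t) : HasParameter (T.reindex (finRotate 3).symm) P t := by
  obtain ⟨h1, h2, h3⟩ := h
  exact ⟨h2, h3, h1⟩

/-- The directed distance from a side line, times the length of that side, is the barycentric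
coordinate times twice the area of the triangle. -/
lemma sideA_mul_signedInfDist (T : Affine.Triangle ℝ Plane) {w₀ w₁ w₂ : ℝ}
    (hw : w₀ + w₁ + w₂ = 1) :
    sideA T * T.signedInfDist 0 (w₀ • T.points 0 + w₁ • T.points 1 + w₂ • T.points 2) =
      w₀ * |cross (T.points 1 - T.points 0) (T.points 2 - T.points 0)| := by
  rw [signedInfDist_barycentric T hw, ← dist_mul_signedInfDist_self, sideA]
  ring

/-- The first summand of the equation is four times the area of the triangle `PBC`. -/
lemma HasParameter.heronTerm_eq {T : Affine.Triangle ℝ Plane} {P : Plane} {t : ℝ}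
    (h : HasParameter T P t) (hP : P ∈ T.interior) :
    heronTerm (sideA T) (sideB T) (sideC T) t = 2 * (sideA T * T.signedInfDist 0 P) := by
  obtain ⟨h1, h2, h3⟩ := h
  obtain ⟨w₀, w₁, w₂, hw, hPw⟩ := exists_barycentric T (T.interior_subset_closedInterior hP)
  rw [hPw, mem_interior_iff T hw] at hP
  have hcross : cross (T.points 1 - P) (T.points 2 - P) =
      w₀ * cross (T.points 1 - T.points 0) (T.points 2 - T.points 0) := by
    rw [hPw, cross_barycentric _ _ _ hw]
  have hsid := sideA_mul_signedInfDist T hw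
  rw [← hPw] at hsid
  have hheron := heron_cross P (T.points 1) (T.points 2)
  have hnn : 0 ≤ 2 * (w₀ * |cross (T.points 1 - T.points 0) (T.points 2 - T.points 0)|) := by
    have := hP.1
    positivity
  rw [heronTerm, ← h1, ← h2, ← h3, hsid, ← Real.sqrt_sq hnn]
  congr 1
  rw [mul_pow, mul_pow, sq_abs, ← mul_pow, ← hcross, sideA]
  linear_combination hheron

/-- The areas of the triangles `PBC`, `PCA`, `PAB` add up to the area of the triangle. -/
lemma HasParameter.heronTerm_sum {T : Affine.Triangle ℝ Plane} {P : Plane} {t : ℝ}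
    (h : HasParameter T P t) (hP : P ∈ T.interior) :
    heronTerm (sideA T) (sideB T) (sideC T) t + heronTerm (sideB T) (sideC T) (sideA T) t +
      heronTerm (sideC T) (sideA T) (sideB T) t = √(heronSq (sideA T) (sideB T) (sideC T)) := by
  set T₁ := T.reindex (finRotate 3).symm with hT₁
  set T₂ := T₁.reindex (finRotate 3).symm with hT₂
  have hP₁ : P ∈ T₁.interior := by rwa [hT₁, Affine.Simplex.interior_reindex]
  have hP₂ : P ∈ T₂.interior := by rwa [hT₂, Affine.Simplex.interior_reindex]
  have e0 := h.heronTerm_eq hP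
  have e1 := h.rotate.heronTerm_eq hP₁
  have e2 := h.rotate.rotate.heronTerm_eq hP₂
  obtain ⟨w₀, w₁, w₂, hw, hPw⟩ := exists_barycentric T (T.interior_subset_closedInterior hP)
  have s0 := sideA_mul_signedInfDist T hw
  have s1 := sideA_mul_signedInfDist T₁ (w₀ := w₁) (w₁ := w₂) (w₂ := w₀) (by linarith)
  have s2 := sideA_mul_signedInfDist T₂ (w₀ := w₂) (w₁ := w₀) (w₂ := w₁) (by linarith)
  have p10 : T₁.points 0 = T.points 1 := rfl
  have p11 : T₁.points 1 = T.points 2 := rfl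
  have p12 : T₁.points 2 = T.points 0 := rfl
  have p20 : T₂.points 0 = T.points 2 := rfl
  have p21 : T₂.points 1 = T.points 0 := rfl
  have p22 : T₂.points 2 = T.points 1 := rfl
  have c1 : cross (T.points 2 - T.points 1) (T.points 0 - T.points 1) =
      cross (T.points 1 - T.points 0) (T.points 2 - T.points 0) := by
    simp only [cross, PiLp.sub_apply]; ring
  have c2 : cross (T.points 0 - T.points 2) (T.points 1 - T.points 2) =
      cross (T.points 1 - T.points 0) (T.points 2 - T.points 0) := by
    simp only [cross, PiLp.sub_apply]; ring
  rw [← hPw] at s0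
  rw [p10, p11, p12, c1, show w₁ • T.points 1 + w₂ • T.points 2 + w₀ • T.points 0 = P by
    rw [hPw]; abel] at s1
  rw [p20, p21, p22, c2, show w₂ • T.points 2 + w₀ • T.points 0 + w₁ • T.points 1 = P by
    rw [hPw]; abel] at s2
  rw [s0] at e0
  rw [s1] at e1
  rw [s2] at e2
  have e1' : heronTerm (sideB T) (sideC T) (sideA T) t = _ := e1
  have e2' : heronTerm (sideC T) (sideA T) (sideB T) t = _ := e2
  rw [e0, e1', e2', sqrt_heronSq]
  linear_combination 2 * |cross (T.points 1 - T.points 0) (T.points 2 - T.points 0)| * hw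

lemma IsMaxPotentialPoint.hasParameter_lambdaMax {T : Affine.Triangle ℝ Plane} {P : Plane}
    (hP : IsMaxPotentialPoint T P) :
    HasParameter T P
      (lambdaMax (sideA T) (sideB T) (sideC T) / (sideA T + sideB T + sideC T)) := by
  obtain ⟨t, ht, h⟩ := hP.exists_hasParameter
  have hs := isTriangleSides T
  obtain ⟨ha, hb, hc, -⟩ := id hs
  obtain ⟨hl, hl'⟩ := lambdaMax_spec hs
  rwa [← (existsUnique_heronTerm_sum_eq hs).unique ⟨ht, h.heronTerm_sum hP.mem_interior⟩
    ⟨div_pos hl (by positivity), lambdaEquation_iff.1 hl'⟩]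

/-- A point of the plane is determined by its distances from the vertices. -/
lemma HasParameter.unique {T : Affine.Triangle ℝ Plane} {P P' : Plane} {t : ℝ}
    (h : HasParameter T P t) (h' : HasParameter T P' t) : P = P' := by
  obtain ⟨h1, h2, h3⟩ := h
  obtain ⟨h1', h2', h3'⟩ := h'
  have hsub : Set.range T.points ⊆ AffineSubspace.perpBisector P P' := by
    rintro _ ⟨i, rfl⟩
    rw [SetLike.mem_coe, AffineSubspace.mem_perpBisector_iff_dist_eq, dist_comm, dist_comm _ P']
    fin_cases i <;> simp <;> linarith
  have hspan : affineSpan ℝ (Set.range T.points) = ⊤ :=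
    T.independent.affineSpan_eq_top_iff_card_eq_finrank_add_one.2 (by simp)
  have hle : ⊤ ≤ AffineSubspace.perpBisector P P' := hspan ▸ affineSpan_le.2 hsub
  exact AffineSubspace.left_mem_perpBisector.1 (hle (AffineSubspace.mem_top ℝ Plane P))

lemma existsUnique_isMaxPotentialPoint (T : Affine.Triangle ℝ Plane) :
    ∃! P, IsMaxPotentialPoint T P := by
  obtain ⟨P, hP⟩ := exists_isMaxPotentialPoint T
  exact ⟨P, hP, fun P' hP' => hP'.hasParameter_lambdaMax.unique hP.hasParameter_lambdaMax⟩

lemma isMaxPotentialPoint_maxPotentialPoint (T : Affine.Triangle ℝ Plane) :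
    IsMaxPotentialPoint T (maxPotentialPoint T) :=
  Classical.epsilon_spec (exists_isMaxPotentialPoint T)

lemma IsMaxPotentialPoint.centerFunction_eq {T : Affine.Triangle ℝ Plane} {P : Plane}
    (hP : IsMaxPotentialPoint T P) :
    centerFunction (sideA T) (sideB T) (sideC T) = 2 * T.signedInfDist 0 P := by
  have ha := (isTriangleSides T).1
  refine mul_left_cancel₀ ha.ne' ?_
  rw [mul_centerFunction ha, hP.hasParameter_lambdaMax.heronTerm_eq hP.mem_interior]
  ring

lemma hasTrilinearRepresentation_maxPotentialPoint :
    HasTrilinearRepresentation maxPotentialPoint centerFunction := by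
  intro T
  have hP := isMaxPotentialPoint_maxPotentialPoint T
  have h1 := hP.reindex (finRotate 3).symm
  refine ⟨2, two_ne_zero, hP.centerFunction_eq, ?_, ?_⟩
  · have := h1.centerFunction_eq
    rwa [Affine.Simplex.signedInfDist_reindex] at this
  · have := (h1.reindex (finRotate 3).symm).centerFunction_eq
    rwa [Affine.Simplex.signedInfDist_reindex, Affine.Simplex.signedInfDist_reindex] at this

end ElectrostaticCenter

theorem mainTheorem6 :
    -- every triangle has exactly one maximum potential point, and it lies inside the triangle
    (∀ T : Affine.Triangle ℝ ElectrostaticCenter.Plane,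
      (∃! P : ElectrostaticCenter.Plane, ElectrostaticCenter.IsMaxPotentialPoint T P) ∧
        ElectrostaticCenter.maxPotentialPoint T ∈ T.interior) ∧
    -- the equation for the parameter has exactly one positive solution
    (∀ a b c : ℝ, ElectrostaticCenter.IsTriangleSides a b c →
      ∃! l : ℝ, 0 < l ∧ ElectrostaticCenter.LambdaEquation a b c l) ∧
    -- the trilinear coordinates of the maximum potential point
    ElectrostaticCenter.HasTrilinearRepresentation
      ElectrostaticCenter.maxPotentialPoint ElectrostaticCenter.centerFunction ∧
    -- the three defining properties of a triangle center function, with order of homogeneity 1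
    ElectrostaticCenter.HomogeneousOfOrder ElectrostaticCenter.centerFunction 1 ∧
    ElectrostaticCenter.SymmetricInLastTwo ElectrostaticCenter.centerFunction ∧
    ElectrostaticCenter.NotIdenticallyZero ElectrostaticCenter.centerFunction ∧
    -- hence a triangle center
    ElectrostaticCenter.IsTriangleCenter ElectrostaticCenter.maxPotentialPoint := by
  open ElectrostaticCenter in
  exact ⟨fun T => ⟨existsUnique_isMaxPotentialPoint T,
      (isMaxPotentialPoint_maxPotentialPoint T).mem_interior⟩,
    fun _ _ _ h => existsUnique_lambdaEquation h,
    hasTrilinearRepresentation_maxPotentialPoint, centerFunction_homogeneous,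
    centerFunction_symmetric, centerFunction_notIdenticallyZero, centerFunction,
    ⟨⟨1, centerFunction_homogeneous⟩, centerFunction_symmetric, centerFunction_notIdenticallyZero⟩,
    hasTrilinearRepresentation_maxPotentialPoint⟩
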